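/- Let $\alpha\in[1,2]$ and $I=[-\pi,\pi]$. For a $2\pi$-periodic function $u$ let $\hat u(k)=\frac1{2\pi}\int_I u(x)e^{-ikx}\,dx$, $k\in\mathbb Z$. Let $(u,v)=\int_I u\bar v\,dx$, $\|u\|=(u,u)^{1/2}$ and $\|u\|_\alpha=\bigl(\sum_{k\in\mathbb Z}(1+|k|^2)^\alpha|\hat u(k)|^2\bigr)^{1/2}$. Let $H^\alpha_{\mathrm{per}}(I)$ be the space of square-integrable periodic functions with $\|u\|_\alpha<\infty$, and let $\mathcal D^\alpha$ be the operator with $\widehat{\mathcal D^\alpha u}(k)=|k|^\alpha\hat u(k)$. For $N\in\mathbb N$ let $V_N=\operatorname{span}\{e^{ikx}:-N\le k\le N\}$ and $P_Nu=\sum_{|k|\le N}\hat u(k)e^{ikx}$. Let $u_0\in H^\alpha_{\mathrm{per}}(I)$ be real-valued. A solution on $[0,T]$ of the fractional Benjamin–Bona–Mahony (fBBM) equation with initial datum $u_0$ is a real-valued $u\in C^1([0,T];H^\alpha_{\mathrm{per}}(I))$ with $u(0)=u_0$ such that $$u_t+u_x+uu_x+\mathcal D^\alpha u_t=0\quad\text{in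 }L^2(I),\text{ for every }t\in[0,T].$$ The semi-discrete Fourier spectral Galerkin (FSG) solution is the real-valued $u_N\in C^1([0,\infty);H^\alpha_{\mathrm{per}}(I))$ with $u_N(t)\in V_N$, $u_N(0)=P_Nu_0$ and $$\bigl((u_N)_t,\phi\bigr)+\bigl((u_N)_t,\mathcal D^\alpha\phi\bigr)=\bigl(u_N+\tfrac12u_N^2,\phi_x\bigr)\qquad\text{for all }\phi\in V_N,\ t\ge0,$$ which is the FSG scheme of the fractional Camassa–Holm equation $u_t+(\kappa_1u+\frac32\gamma u^2)_x+\mathcal D^\alpha u_t=-\kappa_2[2\mathcal D^\alpha(uu_x)+u\mathcal D^\alpha u_x]$ for $(\kappa_1,\gamma,\kappa_2)=(1,\frac13,0)$. **Lemma.** There exist a time $\bar T>0$ and a constant $C$, both depending only on $\alpha$ and $\|u_0\|_\alpha$, such that the following holds. For every $N\in\mathbb N$ the FSG solution $u_N$ exists and is unique, and $$\|u_N(t)\|\le C,\qquad\|u_N(t)\|_\alpha\le C,\qquad\|(u_N)_t(t)\|_\alpha\le C\qquad\text{for all }t\in[0,\bar T].$$ Furthermore, the fBBM equation with initial datum $u_0$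 has exactly one solution $u$ on $[0,\bar T]$, and $u_N\to u$ in $C^1([0,\bar T];H^\alpha_{\mathrm{per}}(I))$ as $N\to\infty$, that is, $$\sup_{t\in[0,\bar T]}\|u_N(t)-u(t)\|_\alpha+\sup_{t\in[0,\bar T]}\|(u_N)_t(t)-u_t(t)\|_\alpha\to0.$$ -/

import Mathlib

open MeasureTheory Set Filter Topology
open scoped ENNReal Real

noncomputable section

namespace FBBM

/-- The circle `ℝ / 2πℤ`; a function on it is a `2π`-periodic function, that is, a periodic
function on `I = [-π, π]`. -/
abbrev Torus : Type := AddCircle (2 * π)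

instance torusPos : Fact (0 < 2 * π) := ⟨Real.two_pi_pos⟩

/-- Square-integrable complex-valued periodic functions. (Haar measure is Lebesgue measure divided
by `2π`, so the elements are those of `L²_per(I)`; only the `L²` topology of this type is used, the
inner product over `I` being `pairing` below.) -/
abbrev L2 : Type := Lp ℂ 2 (AddCircle.haarAddCircle (T := 2 * π))

/-- `(f, g) = ∫_I f(x) conj(g(x)) dx`, with respect to Lebesgue measure (of total mass `2π`). -/
def pairing (f g : Torus → ℂ) : ℂ := ∫ x : Torus, f x * (starRingEnd ℂ) (g x)

/-- `‖f‖ = (∫_I |f(x)|² dx)^{1/2}`. -/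
def l2Norm (f : Torus → ℂ) : ℝ := √(∫ x : Torus, ‖f x‖ ^ 2)

/-! ### Periodic Sobolev spaces -/

theorem fourierCoeff_add_L2 (f g : L2) (k : ℤ) :
    fourierCoeff (f + g : L2) k = fourierCoeff f k + fourierCoeff g k := by
  simp only [← fourierBasis_repr, map_add, lp.coeFn_add, Pi.add_apply]

theorem fourierCoeff_smul_L2 (c : ℂ) (f : L2) (k : ℤ) :
    fourierCoeff (c • f : L2) k = c * fourierCoeff f k := by
  simp only [← fourierBasis_repr, map_smul, lp.coeFn_smul, Pi.smul_apply, smul_eq_mul]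

theorem fourierCoeff_zero_L2 (k : ℤ) : fourierCoeff (0 : L2) k = 0 := by
  simp only [← fourierBasis_repr, map_zero, lp.coeFn_zero, Pi.zero_apply]

/-- The sequence `(1 + |k|²)^{r/2} f̂(k)`. -/
def weightedCoeff (r : ℝ) (f : L2) (k : ℤ) : ℂ :=
  (((1 + (k : ℝ) ^ 2) ^ (r / 2) : ℝ) : ℂ) * fourierCoeff f k

theorem norm_weightedCoeff_sq (r : ℝ) (f : L2) (k : ℤ) :
    ‖weightedCoeff r f k‖ ^ 2 = (1 + (k : ℝ) ^ 2) ^ r * ‖fourierCoeff f k‖ ^ 2 := by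
  have h : (0 : ℝ) ≤ 1 + (k : ℝ) ^ 2 := by positivity
  rw [weightedCoeff, norm_mul, Complex.norm_real, Real.norm_of_nonneg (Real.rpow_nonneg h _),
    mul_pow, ← Real.rpow_natCast, ← Real.rpow_mul h]
  norm_num

theorem memlp_weightedCoeff_iff (r : ℝ) (f : L2) :
    Memℓp (weightedCoeff r f) 2 ↔
      Summable fun k : ℤ => (1 + (k : ℝ) ^ 2) ^ r * ‖fourierCoeff f k‖ ^ 2 := by
  rw [memℓp_gen_iff (by norm_num)]
  simp only [ENNReal.toReal_ofNat, Real.rpow_two, norm_weightedCoeff_sq]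

/-- The functions `f ∈ L²_per(I)` with `∑ (1 + |k|²)^r |f̂(k)|² < ∞`. -/
def sobolevSubmodule (r : ℝ) : Submodule ℂ L2 where
  carrier := {f | Summable fun k : ℤ => (1 + (k : ℝ) ^ 2) ^ r * ‖fourierCoeff f k‖ ^ 2}
  zero_mem' := by
    refine summable_zero.congr fun k => ?_
    rw [fourierCoeff_zero_L2, norm_zero]
    ring
  add_mem' := by
    intro f g hf hg
    simp only [mem_ofPred_eq, ← memlp_weightedCoeff_iff] at *
    convert hf.add hg using 1
    ext k
    simp only [weightedCoeff, Pi.add_apply, fourierCoeff_add_L2, mul_add]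
  smul_mem' := by
    intro c f hf
    simp only [mem_ofPred_eq, ← memlp_weightedCoeff_iff] at *
    convert hf.const_smul c using 1
    ext k
    simp only [weightedCoeff, Pi.smul_apply, smul_eq_mul, fourierCoeff_smul_L2]
    ring

/-- The periodic Sobolev space `H^r_per(I)`, a type of its own so as to carry its own norm. -/
def HPer (r : ℝ) : Type := ↥(sobolevSubmodule r)

namespace HPer

instance (r : ℝ) : AddCommGroup (HPer r) := inferInstanceAs (AddCommGroup ↥(sobolevSubmodule r))

instance (r : ℝ) : Module ℂ (HPer r) := inferInstanceAs (Module ℂ ↥(sobolevSubmodule r))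

/-- The inclusion `H^r_per(I) → L²_per(I)`. -/
def toL2 {r : ℝ} : HPer r →ₗ[ℂ] L2 := (sobolevSubmodule r).subtype

/-- An element of `H^r_per(I)` as a function on the circle. -/
instance (r : ℝ) : CoeFun (HPer r) fun _ => Torus → ℂ := ⟨fun u => (toL2 u : Torus → ℂ)⟩

/-- The map `u ↦ ((1 + |k|²)^{r/2} û(k))_k` into `ℓ²(ℤ)`. -/
def toSeq (r : ℝ) : HPer r →ₗ[ℂ] lp (fun _ : ℤ => ℂ) 2 where
  toFun u := ⟨weightedCoeff r (toL2 u), (memlp_weightedCoeff_iff r _).2 u.2⟩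
  map_add' u v := by
    ext k
    simp only [lp.coeFn_add, Pi.add_apply, weightedCoeff, map_add, fourierCoeff_add_L2, mul_add]
  map_smul' c u := by
    ext k
    simp only [lp.coeFn_smul, Pi.smul_apply, weightedCoeff, map_smul, fourierCoeff_smul_L2,
      RingHom.id_apply, smul_eq_mul]
    ring

theorem toSeq_injective (r : ℝ) : Function.Injective (toSeq r) := by
  intro u v huv
  apply Subtype.ext
  apply fourierBasis.repr.injective
  ext k
  have h := congrArg (fun s : lp (fun _ : ℤ => ℂ) 2 => s k) huv
  have hw : (((1 + (k : ℝ) ^ 2) ^ (r / 2) : ℝ) : ℂ) ≠ 0 := by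
    have : (0 : ℝ) < 1 + (k : ℝ) ^ 2 := by positivity
    exact_mod_cast (Real.rpow_pos_of_pos this _).ne'
  simp only [fourierBasis_repr]
  exact mul_left_cancel₀ hw h

/-- The norm `‖u‖_r = (∑ (1 + |k|²)^r |û(k)|²)^{1/2}`; see `norm_eq`. -/
instance (r : ℝ) : NormedAddCommGroup (HPer r) :=
  NormedAddCommGroup.induced (HPer r) (lp (fun _ : ℤ => ℂ) 2) (toSeq r) (toSeq_injective r)

instance (r : ℝ) : NormedSpace ℂ (HPer r) :=
  NormedSpace.induced ℂ (HPer r) (lp (fun _ : ℤ => ℂ) 2) (toSeq r)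

theorem norm_eq {r : ℝ} (u : HPer r) :
    ‖u‖ = √(∑' k : ℤ, (1 + (k : ℝ) ^ 2) ^ r * ‖fourierCoeff u k‖ ^ 2) := by
  have h : ‖u‖ = ‖toSeq r u‖ := rfl
  rw [h, lp.norm_eq_tsum_rpow (by norm_num), Real.sqrt_eq_rpow]
  simp only [ENNReal.toReal_ofNat, Real.rpow_two]
  congr 1
  exact tsum_congr fun k => norm_weightedCoeff_sq r _ k

end HPer

/-- The function `f` is real-valued. -/
def IsRealValued (f : Torus → ℂ) : Prop := ∀ᵐ x : Torus, (f x).im = 0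

/-! ### Fourier multipliers -/

/-- The Fourier multiplier `∑ m(k) f̂(k) e^{ikx}`, as a sum in `L²_per(I)`; it is meaningful when
that series converges, see `fourierCoeff_multiplier`. -/
def multiplier (m : ℤ → ℂ) (f : L2) : L2 :=
  ∑' k : ℤ, (m k * fourierCoeff f k) • fourierLp (T := 2 * π) 2 k

/-- The fractional Laplacian `𝒟^α f = ∑ |k|^α f̂(k) e^{ikx}`. -/
def fracLap (α : ℝ) : L2 → L2 := multiplier fun k => ((|(k : ℝ)| ^ α : ℝ) : ℂ)

/-- The weak derivative `f_x = ∑ i k f̂(k) e^{ikx}`. -/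
def deriv_x : L2 → L2 := multiplier fun k => Complex.I * (k : ℂ)

theorem fourierCoeff_multiplier {m : ℤ → ℂ} {f : L2}
    (h : Summable fun k : ℤ => ‖m k * fourierCoeff f k‖ ^ 2) (k : ℤ) :
    fourierCoeff (multiplier m f) k = m k * fourierCoeff f k := by
  have hm : Memℓp (fun k : ℤ => m k * fourierCoeff f k) 2 := by
    rw [memℓp_gen_iff (by norm_num)]
    simpa only [ENNReal.toReal_ofNat, Real.rpow_two] using h
  let s : lp (fun _ : ℤ => ℂ) 2 := ⟨fun k : ℤ => m k * fourierCoeff f k, hm⟩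
  have hs := (fourierBasis (T := 2 * π)).hasSum_repr_symm s
  rw [coe_fourierBasis] at hs
  have he : multiplier m f = (fourierBasis (T := 2 * π)).repr.symm s := hs.tsum_eq
  rw [he, ← fourierBasis_repr, LinearIsometryEquiv.apply_symm_apply]

theorem fourierCoeff_multiplier_HPer {r : ℝ} {m : ℤ → ℂ}
    (hm : ∀ k : ℤ, ‖m k‖ ^ 2 ≤ (1 + (k : ℝ) ^ 2) ^ r) (u : HPer r) (k : ℤ) :
    fourierCoeff (multiplier m (HPer.toL2 u)) k = m k * fourierCoeff u k := by
  refine fourierCoeff_multiplier (Summable.of_nonneg_of_le (fun k => by positivity) (fun k => ?_)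
    (show Summable fun k : ℤ => (1 + (k : ℝ) ^ 2) ^ r * ‖fourierCoeff u k‖ ^ 2 from u.2)) k
  rw [norm_mul, mul_pow]
  exact mul_le_mul_of_nonneg_right (hm k) (by positivity)

/-- On `H^α_per(I)` the series defining `𝒟^α` converges. -/
theorem fourierCoeff_fracLap {α : ℝ} (hα : 0 ≤ α) (u : HPer α) (k : ℤ) :
    fourierCoeff (fracLap α (HPer.toL2 u)) k = ((|(k : ℝ)| ^ α : ℝ) : ℂ) * fourierCoeff u k := by
  refine fourierCoeff_multiplier_HPer (fun k => ?_) u k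
  rw [Complex.norm_real, Real.norm_of_nonneg (by positivity), ← Real.rpow_natCast,
    ← Real.rpow_mul (abs_nonneg _), mul_comm, Real.rpow_mul (abs_nonneg _)]
  refine Real.rpow_le_rpow (by positivity) ?_ hα
  norm_num

/-- On `H^α_per(I)`, `α ≥ 1`, the series defining the weak derivative converges. -/
theorem fourierCoeff_deriv_x {α : ℝ} (hα : 1 ≤ α) (u : HPer α) (k : ℤ) :
    fourierCoeff (deriv_x (HPer.toL2 u)) k = Complex.I * (k : ℂ) * fourierCoeff u k := by
  refine fourierCoeff_multiplier_HPer (fun k => ?_) u k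
  have h1 : (1 : ℝ) ≤ 1 + (k : ℝ) ^ 2 := by nlinarith [sq_nonneg (k : ℝ)]
  calc ‖Complex.I * (k : ℂ)‖ ^ 2 = (k : ℝ) ^ 2 := by
        rw [norm_mul, Complex.norm_I, one_mul, Complex.norm_intCast, sq_abs]
    _ ≤ (1 + (k : ℝ) ^ 2) ^ (1 : ℝ) := by rw [Real.rpow_one]; linarith
    _ ≤ (1 + (k : ℝ) ^ 2) ^ α := Real.rpow_le_rpow_of_exponent_le h1 hα

/-! ### The Fourier spectral Galerkin scheme -/

/-- `V_N = span {e^{ikx} : -N ≤ k ≤ N}`. -/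
def trigSpace (N : ℕ) : Submodule ℂ L2 :=
  Submodule.span ℂ ((fun k : ℤ => fourierLp (T := 2 * π) 2 k) '' Icc (-(N : ℤ)) N)

/-- The orthogonal projection `P_N f = ∑_{|k| ≤ N} f̂(k) e^{ikx}`. -/
def proj (N : ℕ) (f : L2) : L2 :=
  ∑ k ∈ Finset.Icc (-(N : ℤ)) N, fourierCoeff f k • fourierLp (T := 2 * π) 2 k

/-- The flux `f(u) = κ₁ u + (3/2) γ u²`. -/
def flux (κ₁ γ : ℝ) (u : Torus → ℂ) (x : Torus) : ℂ := κ₁ * u x + 3 / 2 * γ * u x ^ 2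

/-- `u : [0, ∞) → V_N` is the semi-discrete Fourier spectral Galerkin approximation, with `N` modes
and initial datum `u₀`, of
`u_t + f(u)_x + 𝒟^α u_t = -κ₂ (2 𝒟^α (u u_x) + u 𝒟^α u_x)`.
The values of `u` at negative times are irrelevant. -/
structure IsFSGSolution (κ₁ γ κ₂ α : ℝ) (N : ℕ) (u₀ : HPer α) (u : ℝ → HPer α) : Prop where
  contDiffOn : ContDiffOn ℝ 1 u (Ici 0)
  real : ∀ t ∈ Ici (0 : ℝ), IsRealValued (u t)
  mem : ∀ t ∈ Ici (0 : ℝ), HPer.toL2 (u t) ∈ trigSpace N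
  init : HPer.toL2 (u 0) = proj N (HPer.toL2 u₀)
  galerkin : ∀ t ∈ Ici (0 : ℝ), ∀ φ ∈ trigSpace N,
    pairing (derivWithin u (Ici 0) t : HPer α) φ
        + pairing (derivWithin u (Ici 0) t : HPer α) (fracLap α φ) =
      pairing (flux κ₁ γ (u t)) (deriv_x φ)
        - κ₂ * (2 * pairing (fun x => u t x * deriv_x (HPer.toL2 (u t)) x) (fracLap α φ)
          + pairing (fun x => u t x * fracLap α (deriv_x (HPer.toL2 (u t))) x) φ)

/-- `u ∈ C¹([0, T]; H^α_per(I))` is a real-valued solution of the fractional BBM equation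
`u_t + u_x + u u_x + 𝒟^α u_t = 0`, `u(0) = u₀`, the equation being an identity in `L²` at every
time `t ∈ [0, T]`. The values of `u` outside `[0, T]` are irrelevant. -/
structure IsFBBMSolution (α T : ℝ) (u₀ : HPer α) (u : ℝ → HPer α) : Prop where
  contDiffOn : ContDiffOn ℝ 1 u (Icc 0 T)
  real : ∀ t ∈ Icc 0 T, IsRealValued (u t)
  init : u 0 = u₀
  eqn : ∀ t ∈ Icc 0 T, ∀ᵐ x : Torus,
    (derivWithin u (Icc 0 T) t : HPer α) x + deriv_x (HPer.toL2 (u t)) x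
      + u t x * deriv_x (HPer.toL2 (u t)) x
      + fracLap α (HPer.toL2 (derivWithin u (Icc 0 T) t)) x = 0

end FBBM

end

/-! Applying `(1 + 𝒟^α)⁻¹` turns the fBBM equation into an autonomous ordinary differential equation
`u_t = F(u)` in `H^α`, with `F(u) = -(1 + 𝒟^α)⁻¹(u_x + u u_x)`. No derivative is lost: for `α ≥ 1`
elements of `H^α` are bounded, so `u u_x` lies in `L²`, and the resolvent maps `L²` back into `H^α`.
Hence `F` is Lipschitz on balls (`lipschitzOnWith_field`).

Integration by parts in the Galerkin identity shows that the FSG scheme is the equation `u_t = P_N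
F(u)` (`galerkin_iff`, `isFSGSolution_iff`). Since `P_N` is a contraction on `H^α`, all these fields
have the bounds and Lipschitz constants of `F`. A solution starting at norm at most `‖u₀‖_α`
therefore stays in the ball of radius `‖u₀‖_α + 1` for a time that does not depend on `N`
(`exists_local_solution`); this gives the uniform bounds.

For fixed `N` the solution is global, because `(u, (1 + 𝒟^α)u)` is conserved for real `u` and is
coercive on `V_N` (`exists_global_solution_of_conserved`). The coercivity constant grows with `N`,
so the energy plays no role in the uniform bounds.

For convergence, `P_N → 1` strongly, hence uniformly on the compact curve `{F(u(t))}`. Thus `u`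
solves the `N`-th equation up to a small defect, and Grönwall's inequality gives convergence of
`u_N`; Lipschitz continuity then gives that of the time derivatives
(`tendstoUniformlyOn_solutions`).

Real-valuedness is a closed real-linear condition preserved by `F` and `P_N`, so solutions are
constructed inside that subspace. -/

open scoped NNReal InnerProductSpace

noncomputable section

namespace FBBM

/-! ### Ordinary differential equations with locally Lipschitz fields -/

section AbstractODE

variable {X : Type*} [NormedAddCommGroup X]

/-- The factor by which the radial retraction onto the ball of radius `R` scales `x`. -/
def radialFactor (R : ℝ) (x : X) : ℝ := R / max R ‖x‖

theorem radialFactor_eq_one {R : ℝ} (hR : 0 < R) {x : X} (hx : ‖x‖ ≤ R) :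
    radialFactor R x = 1 := by
  rw [radialFactor, max_eq_left hx, div_self hR.ne']

variable [NormedSpace ℝ X]

theorem norm_radialFactor_smul_le {R : ℝ} (hR : 0 < R) (x : X) :
    ‖radialFactor R x • x‖ ≤ R := by
  have hm : 0 < max R ‖x‖ := lt_max_of_lt_left hR
  rw [norm_smul, radialFactor, Real.norm_of_nonneg (by positivity), div_mul_eq_mul_div,
    div_le_iff₀ hm]
  exact mul_le_mul_of_nonneg_left (le_max_right _ _) hR.le

/-- Write the difference as `ρ(x)(x - y) + (ρ(x) - ρ(y))y`. Each term is at most `‖x - y‖`: the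
first because `ρ ≤ 1`, the second because `t ↦ max R t` is 1-Lipschitz and `‖y‖ ≤ max R ‖y‖`. -/
theorem lipschitzWith_radialFactor_smul {R : ℝ} (hR : 0 < R) :
    LipschitzWith 2 fun x : X => radialFactor R x • x := by
  refine LipschitzWith.of_dist_le_mul fun x y => ?_
  have hx : 0 < max R ‖x‖ := lt_max_of_lt_left hR
  have hy : 0 < max R ‖y‖ := lt_max_of_lt_left hR
  have h1 : ‖radialFactor R x • (x - y)‖ ≤ ‖x - y‖ := by
    rw [norm_smul, radialFactor, Real.norm_of_nonneg (by positivity)]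
    refine mul_le_of_le_one_left (norm_nonneg _) ?_
    rw [div_le_one hx]
    exact le_max_left _ _
  have h2 : ‖(radialFactor R x - radialFactor R y) • y‖ ≤ ‖x - y‖ := by
    have e : radialFactor R x - radialFactor R y
        = R / max R ‖x‖ * ((max R ‖y‖ - max R ‖x‖) / max R ‖y‖) := by
      rw [radialFactor, radialFactor]
      field_simp
    rw [e, norm_smul, norm_mul, norm_div, norm_div, Real.norm_of_nonneg hR.le,
      Real.norm_of_nonneg hx.le, Real.norm_of_nonneg hy.le]
    have h3 : ‖max R ‖y‖ - max R ‖x‖‖ ≤ ‖x - y‖ := by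
      rw [Real.norm_eq_abs, max_comm R, max_comm R]
      refine (abs_max_sub_max_le_abs _ _ _).trans ?_
      rw [norm_sub_rev x y]
      exact abs_norm_sub_norm_le _ _
    have h4 : R / max R ‖x‖ ≤ 1 := by
      rw [div_le_one hx]
      exact le_max_left _ _
    calc R / max R ‖x‖ * (‖max R ‖y‖ - max R ‖x‖‖ / max R ‖y‖) * ‖y‖
        ≤ 1 * (‖max R ‖y‖ - max R ‖x‖‖ / max R ‖y‖) * max R ‖y‖ := by
          gcongr
          exact le_max_right _ _
      _ = ‖max R ‖y‖ - max R ‖x‖‖ := by field_simp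
      _ ≤ ‖x - y‖ := h3
  rw [dist_eq_norm, dist_eq_norm]
  calc ‖radialFactor R x • x - radialFactor R y • y‖
      = ‖radialFactor R x • (x - y) + (radialFactor R x - radialFactor R y) • y‖ := by
        congr 1
        module
    _ ≤ ‖x - y‖ + ‖x - y‖ := norm_add_le_of_le h1 h2
    _ = ((2 : ℝ≥0) : ℝ) * ‖x - y‖ := by push_cast; ring

/-- Two solutions of an autonomous equation whose field is Lipschitz on balls agree. -/
theorem ode_eqOn_Icc {G : X → X} (hG : ∀ R : ℝ, ∃ K : ℝ≥0, LipschitzOnWith K G (Metric.closedBall 0 R))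
    {T : ℝ} {u v : ℝ → X} (hu : ∀ t ∈ Icc 0 T, HasDerivWithinAt u (G (u t)) (Icc 0 T) t)
    (hv : ∀ t ∈ Icc 0 T, HasDerivWithinAt v (G (v t)) (Icc 0 T) t) (h0 : u 0 = v 0) :
    EqOn u v (Icc 0 T) := by
  have hcu : ContinuousOn u (Icc 0 T) := fun t ht => (hu t ht).continuousWithinAt
  have hcv : ContinuousOn v (Icc 0 T) := fun t ht => (hv t ht).continuousWithinAt
  obtain ⟨A, hA⟩ := isCompact_Icc.exists_bound_of_continuousOn hcu
  obtain ⟨B, hB⟩ := isCompact_Icc.exists_bound_of_continuousOn hcv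
  -- Both curves are bounded on the compact interval, so a single ball, with a single Lipschitz
  -- constant, contains them.
  obtain ⟨K, hK⟩ := hG (max A B)
  have hd : ∀ {w : ℝ → X} {t : ℝ}, t ∈ Ico 0 T → HasDerivWithinAt w (G (w t)) (Icc 0 T) t →
      HasDerivWithinAt w (G (w t)) (Ici t) t := by
    intro w t ht h
    exact h.mono_of_mem_nhdsWithin (mem_of_superset (Icc_mem_nhdsGE_of_mem ht) Subset.rfl)
  refine ODE_solution_unique_of_mem_Icc_right (v := fun _ => G)
    (s := fun _ => Metric.closedBall 0 (max A B)) (fun _ _ => hK) hcu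
    (fun t ht => hd ht (hu t (Ico_subset_Icc_self ht))) (fun t ht => ?_) hcv
    (fun t ht => hd ht (hv t (Ico_subset_Icc_self ht))) (fun t ht => ?_) h0
  · simpa using Or.inl (hA t (Ico_subset_Icc_self ht))
  · simpa using Or.inr (hB t (Ico_subset_Icc_self ht))

theorem ode_eqOn_Ici {G : X → X}
    (hG : ∀ R : ℝ, ∃ K : ℝ≥0, LipschitzOnWith K G (Metric.closedBall 0 R))
    {u v : ℝ → X} (hu : ∀ t ∈ Ici (0 : ℝ), HasDerivWithinAt u (G (u t)) (Ici 0) t)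
    (hv : ∀ t ∈ Ici (0 : ℝ), HasDerivWithinAt v (G (v t)) (Ici 0) t) (h0 : u 0 = v 0) :
    EqOn u v (Ici 0) := fun t ht =>
  ode_eqOn_Icc hG (T := t) (fun s hs => (hu s hs.1).mono Icc_subset_Ici_self)
    (fun s hs => (hv s hs.1).mono Icc_subset_Ici_self) h0 ⟨ht, le_rfl⟩

/-- A bounded and Lipschitz field has global forward solutions. -/
theorem exists_global_solution_of_bounded [CompleteSpace X] {G : X → X} {L K : ℝ≥0}
    (hL : ∀ x, ‖G x‖ ≤ L) (hK : LipschitzWith K G) (x₀ : X) :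
    ∃ u : ℝ → X, u 0 = x₀ ∧ ∀ t ∈ Ici (0 : ℝ), HasDerivWithinAt u (G (u t)) (Ici 0) t := by
  have hG : ∀ R : ℝ, ∃ K : ℝ≥0, LipschitzOnWith K G (Metric.closedBall 0 R) :=
    fun R => ⟨K, hK.lipschitzOnWith⟩
  have hex : ∀ n : ℕ, ∃ u : ℝ → X, u 0 = x₀ ∧
      ∀ t ∈ Icc (0 : ℝ) n, HasDerivWithinAt u (G (u t)) (Icc 0 n) t := by
    intro n
    have hp : IsPicardLindelof (fun _ => G) (tmin := 0) (tmax := n)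
        -- Speed at most `L` during time `n` cannot leave the ball of radius `L * n`; since the
        -- bounds on the field are global, any radius is allowed.
        ⟨0, left_mem_Icc.2 n.cast_nonneg⟩ x₀ (L * n) 0 L K := by
      refine .of_time_independent (fun x _ => hL x) hK.lipschitzOnWith ?_
      simp
    exact hp.exists_eq_forall_mem_Icc_hasDerivWithinAt₀
  choose U hU0 hU using hex
  have hmono : ∀ m n : ℕ, m ≤ n → EqOn (U m) (U n) (Icc 0 m) := fun m n hmn =>
    ode_eqOn_Icc hG (hU m)
      (fun t ht => (hU n t ⟨ht.1, ht.2.trans (by exact_mod_cast hmn)⟩).mono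
        (Icc_subset_Icc_right (by exact_mod_cast hmn))) ((hU0 m).trans (hU0 n).symm)
  -- The solutions on `[0, n]` extend one another by uniqueness, so at time `t` the one with `n =
  -- ⌈t⌉₊` may be used.
  have hagree : ∀ n : ℕ, EqOn (fun t => U (⌈t⌉₊) t) (U n) (Icc 0 n) := by
    intro n t ht
    exact hmono _ _ (Nat.ceil_le.2 ht.2) ⟨ht.1, Nat.le_ceil t⟩
  refine ⟨fun t => U (⌈t⌉₊) t, by simp [hU0], fun t ht => ?_⟩
  obtain ⟨n, hn⟩ := exists_nat_gt t
  have htn : t ∈ Icc (0 : ℝ) n := ⟨ht, hn.le⟩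
  have h1 := (hU n t htn).congr (hagree n) (hagree n htn)
  have h2 := h1.mono_of_mem_nhdsWithin (s := Ici 0) (t := Icc 0 (n : ℝ))
    (by
      rw [← Ici_inter_Iic]
      exact inter_mem self_mem_nhdsWithin (mem_nhdsWithin_of_mem_nhds (Iic_mem_nhds hn)))
  rwa [← hagree n htn] at h2

/-- Truncating a field that is Lipschitz on balls. -/
theorem exists_lipschitzWith_truncation {G : X → X}
    (hG : ∀ R : ℝ, ∃ K : ℝ≥0, LipschitzOnWith K G (Metric.closedBall 0 R)) {R : ℝ} (hR : 0 < R) :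
    ∃ K : ℝ≥0, LipschitzWith K fun x => G (radialFactor R x • x) := by
  obtain ⟨K, hK⟩ := hG R
  refine ⟨K * 2, ?_⟩
  have h := hK.comp (lipschitzWith_radialFactor_smul (X := X) hR).lipschitzOnWith (s := univ)
    (fun x _ => by simpa using norm_radialFactor_smul_le hR x)
  exact lipschitzOnWith_univ.1 h

/-- Local solutions stay in a ball for a time that depends only on the size of the field there. -/
theorem exists_local_solution [CompleteSpace X] {G : X → X}
    (hG : ∀ R : ℝ, ∃ K : ℝ≥0, LipschitzOnWith K G (Metric.closedBall 0 R)) {R L T : ℝ}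
    (hR : 0 < R) (hL : ∀ x, ‖x‖ ≤ R → ‖G x‖ ≤ L) {x₀ : X} (hT : ‖x₀‖ + L * T ≤ R) :
    ∃ u : ℝ → X, u 0 = x₀ ∧
      ∀ t ∈ Icc 0 T, HasDerivWithinAt u (G (u t)) (Icc 0 T) t ∧ ‖u t‖ ≤ R := by
  obtain ⟨K, hK⟩ := exists_lipschitzWith_truncation hG hR
  have hL0 : 0 ≤ L := (norm_nonneg _).trans (hL 0 (by simpa using hR.le))
  obtain ⟨u, hu0, hu⟩ := exists_global_solution_of_bounded (L := ⟨L, hL0⟩)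
    (fun x => hL _ (norm_radialFactor_smul_le hR x)) hK x₀
  -- The truncated solution moves at speed at most `L`, so up to time `T` it stays where the
  -- truncation is inactive and solves the original equation.
  have hb : ∀ t ∈ Icc 0 T, ‖u t‖ ≤ R := by
    intro t ht
    have h := (convex_Ici (0 : ℝ)).norm_image_sub_le_of_norm_hasDerivWithin_le hu
      (fun s _ => hL _ (norm_radialFactor_smul_le hR (u s))) self_mem_Ici (show t ∈ Ici 0 from ht.1)
    rw [hu0, sub_zero, Real.norm_of_nonneg ht.1] at h
    calc ‖u t‖ = ‖x₀ + (u t - x₀)‖ := by rw [add_sub_cancel]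
      _ ≤ ‖x₀‖ + L * t := norm_add_le_of_le le_rfl h
      _ ≤ ‖x₀‖ + L * T := by gcongr; exact ht.2
      _ ≤ R := hT
  refine ⟨u, hu0, fun t ht => ⟨?_, hb t ht⟩⟩
  have h := (hu t ht.1).mono (Icc_subset_Ici_self : Icc 0 T ⊆ Ici 0)
  rwa [radialFactor_eq_one hR (hb t ht), one_smul] at h

/-- A coercive quadratic form that is conserved by all the rescaled fields `x ↦ G (c x)` yields
global forward solutions. -/
theorem exists_global_solution_of_conserved [CompleteSpace X] {G : X → X}
    (hG : ∀ R : ℝ, ∃ K : ℝ≥0, LipschitzOnWith K G (Metric.closedBall 0 R))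
    (b : X →L[ℝ] X →L[ℝ] ℝ) (hsymm : ∀ x y, b x y = b y x) {c : ℝ}
    (hcoer : ∀ x, ‖x‖ ^ 2 ≤ c * b x x) (hcons : ∀ (a : ℝ) x, b x (G (a • x)) = 0) (x₀ : X) :
    ∃ u : ℝ → X, u 0 = x₀ ∧ ∀ t ∈ Ici (0 : ℝ), HasDerivWithinAt u (G (u t)) (Ici 0) t := by
  -- The square root is the bound that conservation and coercivity impose on the norm; adding 1
  -- makes the radius positive.
  set R : ℝ := √(c * b x₀ x₀) + 1
  have hR : 0 < R := by positivity
  obtain ⟨K, hK⟩ := exists_lipschitzWith_truncation hG hR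
  obtain ⟨K', hK'⟩ := hG R
  have hL : ∀ x, ‖G (radialFactor R x • x)‖ ≤ (K' * ⟨R, hR.le⟩ + ‖G 0‖₊ : ℝ≥0) := by
    intro x
    have h := hK'.norm_sub_le (x := radialFactor R x • x) (y := 0)
      (by simpa using norm_radialFactor_smul_le hR x) (by simpa using hR.le)
    rw [sub_zero] at h
    push_cast
    calc ‖G (radialFactor R x • x)‖ ≤ ‖G (radialFactor R x • x) - G 0‖ + ‖G 0‖ :=
          norm_le_norm_sub_add _ _
      _ ≤ K' * R + ‖G 0‖ := by
          gcongr
          exact h.trans (mul_le_mul_of_nonneg_left (norm_radialFactor_smul_le hR x) K'.2)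
  obtain ⟨u, hu0, hu⟩ := exists_global_solution_of_bounded hL hK x₀
  -- The truncated field is `G (a • x)` with `a` depending on `x`, which is why conservation is
  -- assumed for every rescaling: it holds before the solution is known to stay in the ball.
  have henergy : ∀ t ∈ Ici (0 : ℝ), b (u t) (u t) = b x₀ x₀ := by
    intro t ht
    have hd : ∀ s ∈ Ici (0 : ℝ), HasDerivWithinAt (fun s => b (u s) (u s)) 0 (Ici 0) s := by
      intro s hs
      have h := (b.hasFDerivAt.comp_hasDerivWithinAt s (hu s hs)).clm_apply (hu s hs)
      refine h.congr_deriv ?_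
      simp [hsymm (G _) (u s), hcons]
    have h := (convex_Ici (0 : ℝ)).norm_image_sub_le_of_norm_hasDerivWithin_le (C := 0) hd
      (fun s _ => by simp) self_mem_Ici ht
    rw [zero_mul, norm_le_zero_iff, sub_eq_zero, hu0] at h
    exact h
  have hb : ∀ t ∈ Ici (0 : ℝ), ‖u t‖ ≤ R := by
    intro t ht
    refine (Real.le_sqrt_of_sq_le ?_).trans (le_add_of_nonneg_right zero_le_one)
    rw [← henergy t ht]
    exact hcoer _
  refine ⟨u, hu0, fun t ht => ?_⟩
  have h := hu t ht
  rwa [radialFactor_eq_one hR (hb t ht), one_smul] at h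

/-- Strongly convergent contractions converge uniformly on compact sets. -/
theorem eventually_norm_sub_le_of_isCompact {P : ℕ → X →L[ℝ] X} (hP : ∀ n, ‖P n‖ ≤ 1)
    (hlim : ∀ x, Tendsto (fun n => P n x) atTop (𝓝 x)) {S : Set X} (hS : IsCompact S) {ε : ℝ}
    (hε : 0 < ε) : ∀ᶠ n in atTop, ∀ x ∈ S, ‖P n x - x‖ ≤ ε := by
  obtain ⟨F, -, hF, hcov⟩ := hS.finite_cover_balls (e := ε / 4) (by positivity)
  have h1 : ∀ᶠ n in atTop, ∀ y ∈ F, ‖P n y - y‖ ≤ ε / 4 := by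
    refine (eventually_all_finite hF).2 fun y _ => ?_
    have := (tendsto_iff_norm_sub_tendsto_zero.1 (hlim y)).eventually
      (gt_mem_nhds (show (0 : ℝ) < ε / 4 by positivity))
    exact this.mono fun n h => h.le
  refine h1.mono fun n hn x hx => ?_
  obtain ⟨y, hy, hxy⟩ := mem_iUnion₂.1 (hcov hx)
  have hxy' : ‖x - y‖ ≤ ε / 4 := by
    rw [← dist_eq_norm]
    exact (Metric.mem_ball.1 hxy).le
  have h2 : ‖P n (x - y)‖ ≤ ε / 4 := ((P n).le_of_opNorm_le (hP n) _).trans (by simpa using hxy')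
  calc ‖P n x - x‖ = ‖P n (x - y) + (P n y - y) - (x - y)‖ := by
        rw [map_sub]
        congr 1
        abel
    _ ≤ ε / 4 + ε / 4 + ε / 4 := norm_sub_le_of_le (norm_add_le_of_le h2 (hn y hy)) hxy'
    _ ≤ ε := by linarith

/-- Convergence of approximate solutions, in `C¹`, when the fields are `P n ∘ G`. -/
theorem tendstoUniformlyOn_solutions {G : X → X} {P : ℕ → X →L[ℝ] X} (hP : ∀ n, ‖P n‖ ≤ 1)
    (hlim : ∀ x, Tendsto (fun n => P n x) atTop (𝓝 x)) {R T : ℝ} {K : ℝ≥0} (hT : 0 ≤ T)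
    (hK : LipschitzOnWith K G (Metric.closedBall 0 R)) {u : ℝ → X} {U : ℕ → ℝ → X} {x₀ : X}
    (hu0 : u 0 = x₀) (hU0 : ∀ n, U n 0 = P n x₀)
    (hu : ∀ t ∈ Icc 0 T, HasDerivWithinAt u (G (u t)) (Icc 0 T) t)
    (hU : ∀ n, ∀ t ∈ Icc 0 T, HasDerivWithinAt (U n) (P n (G (U n t))) (Icc 0 T) t)
    (hub : ∀ t ∈ Icc 0 T, ‖u t‖ ≤ R) (hUb : ∀ n, ∀ t ∈ Icc 0 T, ‖U n t‖ ≤ R) :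
    TendstoUniformlyOn U u atTop (Icc 0 T) ∧
      TendstoUniformlyOn (fun n t => P n (G (U n t))) (fun t => G (u t)) atTop (Icc 0 T) := by
  have hcu : ContinuousOn u (Icc 0 T) := fun t ht => (hu t ht).continuousWithinAt
  have hcU : ∀ n, ContinuousOn (U n) (Icc 0 T) := fun n t ht => (hU n t ht).continuousWithinAt
  have hcGu : ContinuousOn (fun t => G (u t)) (Icc 0 T) :=
    hK.continuousOn.comp hcu fun t ht => by simpa using hub t ht
  have hKP : ∀ n, LipschitzOnWith K (fun x => P n (G x)) (Metric.closedBall 0 R) := by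
    intro n
    refine LipschitzOnWith.of_dist_le_mul fun x hx y hy => ?_
    rw [dist_eq_norm, ← map_sub]
    refine ((P n).le_of_opNorm_le (hP n) _).trans ?_
    rw [one_mul, ← dist_eq_norm]
    exact hK.dist_le_mul x hx y hy
  have hd : ∀ {w : ℝ → X} {w' : X} {t : ℝ}, t ∈ Ico 0 T → HasDerivWithinAt w w' (Icc 0 T) t →
      HasDerivWithinAt w w' (Ici t) t := by
    intro w w' t ht h
    exact h.mono_of_mem_nhdsWithin (mem_of_superset (Icc_mem_nhdsGE_of_mem ht) Subset.rfl)
  -- The Grönwall bound is homogeneous in the initial error and the defect together, so errors of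
  -- size `ε` propagate to at most `ε * M`.
  set M : ℝ := gronwallBound 1 K 1 T + 1
  have hM0 : 0 < M := by
    have : 0 ≤ gronwallBound 1 K 1 T := by
      refine zero_le_one.trans ?_
      have h := gronwallBound_mono (δ := 1) (K := (K : ℝ)) (ε := 1) zero_le_one zero_le_one K.2 hT
      rwa [gronwallBound_x0] at h
    positivity
  have key : ∀ ε > 0, ∀ᶠ n in atTop, ∀ t ∈ Icc 0 T,
      ‖U n t - u t‖ ≤ ε * M ∧ ‖P n (G (U n t)) - G (u t)‖ ≤ K * (ε * M) + ε := by
    intro ε hε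
    have h0 : ∀ᶠ n in atTop, ‖P n x₀ - x₀‖ ≤ ε :=
      (eventually_norm_sub_le_of_isCompact hP hlim isCompact_singleton hε).mono
        fun n h => h x₀ rfl
    -- The image of `[0, T]` under `t ↦ G (u t)` is compact, so strong convergence of `P n` is
    -- uniform along it.
    have h1 := eventually_norm_sub_le_of_isCompact hP hlim (isCompact_Icc.image_of_continuousOn hcGu) hε
    filter_upwards [h0, h1] with n hn0 hn1
    have hn1' : ∀ t ∈ Icc 0 T, ‖P n (G (u t)) - G (u t)‖ ≤ ε := fun t ht =>
      hn1 _ (mem_image_of_mem _ ht)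
    have hgr : ∀ t ∈ Icc 0 T, ‖U n t - u t‖ ≤ ε * M := by
      intro t ht
      -- `U n` is an exact trajectory of `P n ∘ G` (defect 0), and `u` an approximate one, with
      -- defect `‖P n (G u) - G u‖ ≤ ε`.
      have h := dist_le_of_approx_trajectories_ODE_of_mem (v := fun _ x => P n (G x))
        (s := fun _ => Metric.closedBall 0 R) (K := K) (εf := 0) (εg := ε) (δ := ε)
        (fun _ _ => hKP n) (hcU n)
        (fun t ht => hd ht (hU n t (Ico_subset_Icc_self ht))) (fun t _ => by simp)
        (fun t ht => by simpa using hUb n t (Ico_subset_Icc_self ht)) hcu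
        (fun t ht => hd ht (hu t (Ico_subset_Icc_self ht)))
        (fun t ht => by
          rw [dist_comm, dist_eq_norm]
          exact hn1' t (Ico_subset_Icc_self ht))
        (fun t ht => by simpa using hub t (Ico_subset_Icc_self ht))
        (by rwa [hU0, hu0, dist_eq_norm]) t ht
      rw [dist_eq_norm, zero_add, sub_zero] at h
      have h2 : gronwallBound ε K ε T = ε * gronwallBound 1 K 1 T := by
        by_cases hK0 : (K : ℝ) = 0
        · rw [hK0, gronwallBound_K0, gronwallBound_K0]
          ring
        · rw [gronwallBound_of_K_ne_0 hK0, gronwallBound_of_K_ne_0 hK0]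
          ring
      calc ‖U n t - u t‖ ≤ gronwallBound ε K ε t := h
        _ ≤ gronwallBound ε K ε T := gronwallBound_mono hε.le hε.le K.2 ht.2
        _ = ε * gronwallBound 1 K 1 T := h2
        _ ≤ ε * M := by
          gcongr
          exact le_add_of_nonneg_right zero_le_one
    intro t ht
    refine ⟨hgr t ht, ?_⟩
    have h3 := (hKP n).norm_sub_le (x := U n t) (y := u t) (by simpa using hUb n t ht)
      (by simpa using hub t ht)
    calc ‖P n (G (U n t)) - G (u t)‖
        = ‖(P n (G (U n t)) - P n (G (u t))) + (P n (G (u t)) - G (u t))‖ := by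
          rw [sub_add_sub_cancel]
      _ ≤ K * (ε * M) + ε := norm_add_le_of_le
          (h3.trans (mul_le_mul_of_nonneg_left (hgr t ht) K.2)) (hn1' t ht)
  have hKM : 0 < K * M + M + 1 := by positivity
  constructor
  · rw [Metric.tendstoUniformlyOn_iff]
    intro η hη
    filter_upwards [key (η / (K * M + M + 1) / 2) (by positivity)] with n hn t ht
    rw [dist_comm, dist_eq_norm]
    refine (hn t ht).1.trans_lt ?_
    have : η / (K * M + M + 1) / 2 * M ≤ η / (K * M + M + 1) / 2 * (K * M + M + 1) := by
      gcongr
      have : 0 ≤ K * M := by positivity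
      linarith
    have e : η / (K * M + M + 1) / 2 * (K * M + M + 1) = η / 2 := by field_simp
    linarith
  · rw [Metric.tendstoUniformlyOn_iff]
    intro η hη
    filter_upwards [key (η / (K * M + M + 1) / 2) (by positivity)] with n hn t ht
    rw [dist_comm, dist_eq_norm]
    refine (hn t ht).2.trans_lt ?_
    have : K * (η / (K * M + M + 1) / 2 * M) + η / (K * M + M + 1) / 2
        ≤ η / (K * M + M + 1) / 2 * (K * M + M + 1) := by
      have : 0 ≤ η / (K * M + M + 1) / 2 * M := by positivity
      nlinarith
    have e : η / (K * M + M + 1) / 2 * (K * M + M + 1) = η / 2 := by field_simp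
    linarith

end AbstractODE

/-! ### Fourier coefficients as functionals -/

/-- The `k`-th Fourier coefficient on `L²_per(I)`. -/
def coef (k : ℤ) : L2 →L[ℂ] ℂ := innerSL ℂ (fourierLp (T := 2 * π) 2 k)

theorem coef_apply (k : ℤ) (f : L2) : coef k f = fourierCoeff f k := by
  rw [coef, innerSL_apply_apply, ← fourierBasis_repr, HilbertBasis.repr_apply_apply,
    coe_fourierBasis]

theorem L2_ext {f g : L2} (h : ∀ k, coef k f = coef k g) : f = g := by
  apply fourierBasis.repr.injective
  ext k
  rw [fourierBasis_repr, fourierBasis_repr, ← coef_apply, ← coef_apply, h]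

theorem coef_fourierLp (j k : ℤ) :
    coef j (fourierLp (T := 2 * π) 2 k) = if j = k then 1 else 0 :=
  orthonormal_iff_ite.1 (orthonormal_fourier (T := 2 * π)) j k

theorem HPer_ext {r : ℝ} {u v : HPer r}
    (h : ∀ k, coef k (HPer.toL2 u) = coef k (HPer.toL2 v)) : u = v :=
  Subtype.ext (L2_ext h)

theorem hasSum_inner (f g : L2) :
    HasSum (fun k => (starRingEnd ℂ) (coef k f) * coef k g) ⟪f, g⟫_ℂ := by
  have h := (fourierBasis (T := 2 * π)).hasSum_inner_mul_inner f g
  rw [coe_fourierBasis] at h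
  have e : (fun k => (starRingEnd ℂ) (coef k f) * coef k g) =
      fun k => ⟪f, fourierLp (T := 2 * π) 2 k⟫_ℂ * ⟪fourierLp (T := 2 * π) 2 k, g⟫_ℂ :=
    funext fun k => congrArg (· * coef k g) (inner_conj_symm f (fourierLp (T := 2 * π) 2 k))
  rw [e]
  exact h

/-! ### Weights and diagonal operators -/

/-- The weight `(1 + |k|²)^{r/2}`. -/
def weight (r : ℝ) (k : ℤ) : ℝ := (1 + (k : ℝ) ^ 2) ^ (r / 2)

theorem weight_pos (r : ℝ) (k : ℤ) : 0 < weight r k := Real.rpow_pos_of_pos (by positivity) _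

theorem one_le_weight {r : ℝ} (hr : 0 ≤ r) (k : ℤ) : 1 ≤ weight r k :=
  Real.one_le_rpow (by nlinarith [sq_nonneg (k : ℝ)]) (by positivity)

theorem weight_sq (r : ℝ) (k : ℤ) : weight r k ^ 2 = (1 + (k : ℝ) ^ 2) ^ r := by
  rw [weight, ← Real.rpow_natCast, ← Real.rpow_mul (by positivity)]
  norm_num

theorem abs_rpow_le_weight {r : ℝ} (hr : 0 ≤ r) (k : ℤ) : |(k : ℝ)| ^ r ≤ weight r k := by
  have h : |(k : ℝ)| ^ r = ((k : ℝ) ^ 2) ^ (r / 2) := by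
    rw [← sq_abs, ← Real.rpow_natCast, ← Real.rpow_mul (abs_nonneg _)]
    congr 1
    push_cast
    ring
  rw [h]
  exact Real.rpow_le_rpow (by positivity) (by linarith) (by positivity)

theorem abs_le_weight {r : ℝ} (hr : 1 ≤ r) (k : ℤ) : |(k : ℝ)| ≤ weight r k := by
  calc |(k : ℝ)| = |(k : ℝ)| ^ (1 : ℝ) := (Real.rpow_one _).symm
    _ ≤ weight 1 k := abs_rpow_le_weight zero_le_one k
    _ ≤ weight r k := Real.rpow_le_rpow_of_exponent_le (by nlinarith [sq_nonneg (k : ℝ)])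
        (by linarith)

/-- With `m = max 1 |k|` one has `1 + k² ≤ (2m)²` and `m^r ≤ 1 + |k|^r`. This is what makes `(1 +
𝒟^r)⁻¹` bounded from `L²` to `H^r`. -/
theorem weight_le {r : ℝ} (hr : 0 ≤ r) (k : ℤ) : weight r k ≤ 2 ^ r * (1 + |(k : ℝ)| ^ r) := by
  set m : ℝ := max 1 |(k : ℝ)|
  have hm : 1 ≤ m := le_max_left _ _
  have hk : |(k : ℝ)| ≤ m := le_max_right _ _
  have h1 : 1 + (k : ℝ) ^ 2 ≤ (2 * m) ^ 2 := by
    rw [← sq_abs]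
    nlinarith [abs_nonneg (k : ℝ)]
  have h2 : m ^ r ≤ 1 + |(k : ℝ)| ^ r := by
    have h0 : 0 ≤ |(k : ℝ)| ^ r := by positivity
    rcases max_choice 1 |(k : ℝ)| with h | h
    · rw [show m = 1 from h, Real.one_rpow]
      linarith
    · rw [show m = |(k : ℝ)| from h]
      linarith
  calc weight r k ≤ ((2 * m) ^ 2) ^ (r / 2) :=
        Real.rpow_le_rpow (by positivity) h1 (by positivity)
    _ = (2 * m) ^ r := by
        rw [← Real.rpow_natCast, ← Real.rpow_mul (by positivity)]
        congr 1
        push_cast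
        ring
    _ = 2 ^ r * m ^ r := Real.mul_rpow (by norm_num) (by positivity)
    _ ≤ 2 ^ r * (1 + |(k : ℝ)| ^ r) := by gcongr

/-- The diagonal operator on `ℓ²(ℤ)` with bounded entries `m`. -/
def diag {m : ℤ → ℂ} {C : ℝ} (hm : ∀ k, ‖m k‖ ≤ C) :
    lp (fun _ : ℤ => ℂ) 2 →L[ℂ] lp (fun _ : ℤ => ℂ) 2 :=
  have hC : 0 ≤ C := (norm_nonneg _).trans (hm 0)
  have hle : ∀ s : lp (fun _ : ℤ => ℂ) 2, ∀ k, ‖m k * s k‖ ^ (2 : ℝ≥0∞).toReal ≤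
      C ^ (2 : ℝ≥0∞).toReal * ‖s k‖ ^ (2 : ℝ≥0∞).toReal := fun s k => by
    rw [← Real.mul_rpow hC (norm_nonneg _), norm_mul]
    exact Real.rpow_le_rpow (by positivity)
      (mul_le_mul_of_nonneg_right (hm k) (norm_nonneg _)) (by norm_num)
  have hsum : ∀ s : lp (fun _ : ℤ => ℂ) 2, Summable fun k =>
      C ^ (2 : ℝ≥0∞).toReal * ‖s k‖ ^ (2 : ℝ≥0∞).toReal := fun s =>
    ((lp.memℓp s).summable (by norm_num)).mul_left _
  LinearMap.mkContinuous
    { toFun := fun s => ⟨fun k => m k * s k, memℓp_gen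
        (Summable.of_nonneg_of_le (fun k => by positivity) (hle s) (hsum s))⟩
      map_add' := fun s t => by
        ext k
        exact mul_add _ _ _
      map_smul' := fun c s => by
        ext k
        simp only [lp.coeFn_smul, Pi.smul_apply, smul_eq_mul, RingHom.id_apply]
        ring } C fun s => by
    refine lp.norm_le_of_tsum_le (by norm_num) (by positivity) ?_
    rw [Real.mul_rpow hC (norm_nonneg _), lp.norm_rpow_eq_tsum (by norm_num), ← tsum_mul_left]
    exact (Summable.of_nonneg_of_le (fun k => by positivity) (hle s) (hsum s)).tsum_le_tsum
      (hle s) (hsum s)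

theorem diag_apply {m : ℤ → ℂ} {C : ℝ} (hm : ∀ k, ‖m k‖ ≤ C) (s : lp (fun _ : ℤ => ℂ) 2)
    (k : ℤ) : diag hm s k = m k * s k := rfl

theorem norm_diag_le {m : ℤ → ℂ} {C : ℝ} (hm : ∀ k, ‖m k‖ ≤ C) : ‖diag hm‖ ≤ C := by
  unfold diag
  exact LinearMap.mkContinuous_norm_le _ ((norm_nonneg _).trans (hm 0)) _

theorem norm_inv_weight_le {r : ℝ} (hr : 0 ≤ r) (k : ℤ) : ‖((weight r k : ℝ) : ℂ)⁻¹‖ ≤ 1 := by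
  rw [norm_inv, Complex.norm_real, Real.norm_of_nonneg (weight_pos r k).le]
  exact inv_le_one_of_one_le₀ (one_le_weight hr k)

theorem toSeq_apply {r : ℝ} (u : HPer r) (k : ℤ) :
    HPer.toSeq r u k = weight r k * coef k (HPer.toL2 u) := by
  rw [coef_apply]
  rfl

theorem weight_ne_zero (r : ℝ) (k : ℤ) : ((weight r k : ℝ) : ℂ) ≠ 0 :=
  Complex.ofReal_ne_zero.2 (weight_pos r k).ne'

/-- The weights are at least 1, so dividing an `ℓ²` sequence by them leaves it in `ℓ²`, where it is
the coefficient sequence of an `L²` function. -/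
theorem toSeq_surjective {r : ℝ} (hr : 0 ≤ r) : Function.Surjective (HPer.toSeq r) := by
  intro s
  set f : L2 := (fourierBasis (T := 2 * π)).repr.symm (diag (norm_inv_weight_le hr) s)
  have hf : ∀ k, fourierCoeff f k = ((weight r k : ℝ) : ℂ)⁻¹ * s k := fun k => by
    rw [← fourierBasis_repr, LinearIsometryEquiv.apply_symm_apply, diag_apply]
  have hw : weightedCoeff r f = s := by
    ext k
    rw [weightedCoeff, hf]
    exact mul_inv_cancel_left₀ (weight_ne_zero r k) _
  have hmem : f ∈ sobolevSubmodule r := by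
    refine (memlp_weightedCoeff_iff r f).1 ?_
    rw [hw]
    exact lp.memℓp s
  refine ⟨(⟨f, hmem⟩ : ↥(sobolevSubmodule r)), ?_⟩
  ext k
  exact congrFun hw k

/-- `H^r_per(I)` is isometric to `ℓ²(ℤ)`. -/
def seqEquiv {r : ℝ} (hr : 0 ≤ r) : HPer r ≃ₗᵢ[ℂ] lp (fun _ : ℤ => ℂ) 2 :=
  LinearIsometryEquiv.ofSurjective ⟨HPer.toSeq r, fun _ => rfl⟩ (toSeq_surjective hr)

theorem seqEquiv_apply {r : ℝ} (hr : 0 ≤ r) (u : HPer r) (k : ℤ) :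
    seqEquiv hr u k = weight r k * coef k (HPer.toL2 u) := toSeq_apply u k

theorem coef_seqEquiv_symm {r : ℝ} (hr : 0 ≤ r) (s : lp (fun _ : ℤ => ℂ) 2) (k : ℤ) :
    coef k (HPer.toL2 ((seqEquiv hr).symm s)) = ((weight r k : ℝ) : ℂ)⁻¹ * s k := by
  have h := seqEquiv_apply hr ((seqEquiv hr).symm s) k
  rw [LinearIsometryEquiv.apply_symm_apply] at h
  rw [h, inv_mul_cancel_left₀ (weight_ne_zero r k)]

theorem completeSpace_HPer {r : ℝ} (hr : 0 ≤ r) : CompleteSpace (HPer r) :=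
  (completeSpace_congr (e := (seqEquiv hr).toIsometryEquiv.toEquiv)
    (seqEquiv hr).isometry.isUniformEmbedding).2 inferInstance

/-- The Fourier multiplier with symbol `m` as a bounded operator `H^r → L²`. -/
def multOp {r : ℝ} {m : ℤ → ℂ} {C : ℝ} (hr : 0 ≤ r)
    (hm : ∀ k, ‖m k * ((weight r k : ℝ) : ℂ)⁻¹‖ ≤ C) : HPer r →L[ℂ] L2 :=
  ((fourierBasis (T := 2 * π)).repr.symm.toContinuousLinearEquiv : _ →L[ℂ] L2) ∘L
    diag hm ∘L ((seqEquiv hr).toContinuousLinearEquiv : HPer r →L[ℂ] _)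

theorem coef_multOp {r : ℝ} {m : ℤ → ℂ} {C : ℝ} (hr : 0 ≤ r)
    (hm : ∀ k, ‖m k * ((weight r k : ℝ) : ℂ)⁻¹‖ ≤ C) (u : HPer r) (k : ℤ) :
    coef k (multOp hr hm u) = m k * coef k (HPer.toL2 u) := by
  rw [coef_apply, ← fourierBasis_repr]
  simp only [multOp, ContinuousLinearMap.coe_comp, Function.comp_apply,
    ContinuousLinearEquiv.coe_coe, LinearIsometryEquiv.coe_toContinuousLinearEquiv,
    LinearIsometryEquiv.apply_symm_apply, diag_apply, seqEquiv_apply]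
  rw [mul_assoc, inv_mul_cancel_left₀ (weight_ne_zero r k)]

theorem norm_symbol_le {r : ℝ} {m : ℤ → ℂ} (hm : ∀ k, ‖m k‖ ≤ weight r k) (k : ℤ) :
    ‖m k * ((weight r k : ℝ) : ℂ)⁻¹‖ ≤ 1 := by
  rw [norm_mul, norm_inv, Complex.norm_real, Real.norm_of_nonneg (weight_pos r k).le,
    ← div_eq_mul_inv, div_le_one (weight_pos r k)]
  exact hm k

/-- The inclusion `H^r → L²`, as a bounded operator. -/
def incl {r : ℝ} (hr : 0 ≤ r) : HPer r →L[ℂ] L2 :=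
  multOp hr (m := fun _ => 1) (norm_symbol_le fun k => by simpa using one_le_weight hr k)

theorem incl_apply {r : ℝ} (hr : 0 ≤ r) (u : HPer r) : incl hr u = HPer.toL2 u :=
  L2_ext fun k => by rw [incl, coef_multOp, one_mul]

/-- The derivative `H^r → L²`, `r ≥ 1`. -/
def dx {r : ℝ} (hr : 1 ≤ r) : HPer r →L[ℂ] L2 :=
  multOp (zero_le_one.trans hr) (m := fun k => Complex.I * (k : ℂ)) (norm_symbol_le fun k => by
    simpa using abs_le_weight hr k)

theorem coef_dx {r : ℝ} (hr : 1 ≤ r) (u : HPer r) (k : ℤ) :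
    coef k (dx hr u) = Complex.I * k * coef k (HPer.toL2 u) := coef_multOp _ _ u k

theorem dx_apply {r : ℝ} (hr : 1 ≤ r) (u : HPer r) : dx hr u = deriv_x (HPer.toL2 u) :=
  L2_ext fun k => by rw [coef_dx, coef_apply, coef_apply, fourierCoeff_deriv_x hr]

/-- The fractional Laplacian `𝒟^r : H^r → L²`. -/
def frac {r : ℝ} (hr : 0 ≤ r) : HPer r →L[ℂ] L2 :=
  multOp hr (m := fun k => ((|(k : ℝ)| ^ r : ℝ) : ℂ)) (norm_symbol_le fun k => by
    rw [Complex.norm_real, Real.norm_of_nonneg (by positivity)]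
    exact abs_rpow_le_weight hr k)

theorem coef_frac {r : ℝ} (hr : 0 ≤ r) (u : HPer r) (k : ℤ) :
    coef k (frac hr u) = ((|(k : ℝ)| ^ r : ℝ) : ℂ) * coef k (HPer.toL2 u) := coef_multOp _ _ u k

theorem frac_apply {r : ℝ} (hr : 0 ≤ r) (u : HPer r) : frac hr u = fracLap r (HPer.toL2 u) :=
  L2_ext fun k => by rw [coef_frac, coef_apply, coef_apply, fourierCoeff_fracLap hr]

theorem norm_resolvent_symbol_le {r : ℝ} (hr : 0 ≤ r) (k : ℤ) :
    ‖((weight r k / (1 + |(k : ℝ)| ^ r) : ℝ) : ℂ)‖ ≤ 2 ^ r := by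
  have h0 : 0 ≤ |(k : ℝ)| ^ r := by positivity
  rw [Complex.norm_real, Real.norm_of_nonneg (div_nonneg (weight_pos r k).le (by positivity)),
    div_le_iff₀ (by positivity)]
  exact weight_le hr k

/-- The operator `(1 + 𝒟^r)⁻¹ : L² → H^r`. -/
def resolvent {r : ℝ} (hr : 0 ≤ r) : L2 →L[ℂ] HPer r :=
  ((seqEquiv hr).symm.toContinuousLinearEquiv : _ →L[ℂ] HPer r) ∘L
    diag (norm_resolvent_symbol_le hr) ∘L
      ((fourierBasis (T := 2 * π)).repr.toContinuousLinearEquiv : L2 →L[ℂ] _)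

theorem coef_resolvent {r : ℝ} (hr : 0 ≤ r) (f : L2) (k : ℤ) :
    coef k (HPer.toL2 (resolvent hr f)) = ((1 + |(k : ℝ)| ^ r : ℝ) : ℂ)⁻¹ * coef k f := by
  simp only [resolvent, ContinuousLinearMap.coe_comp, Function.comp_apply,
    ContinuousLinearEquiv.coe_coe, LinearIsometryEquiv.coe_toContinuousLinearEquiv,
    coef_seqEquiv_symm, diag_apply, fourierBasis_repr]
  have h := weight_ne_zero r k
  rw [coef_apply, Complex.ofReal_div]
  field_simp

theorem resolvent_symbol_ne_zero (r : ℝ) (k : ℤ) : ((1 + |(k : ℝ)| ^ r : ℝ) : ℂ) ≠ 0 := by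
  have h0 : 0 ≤ |(k : ℝ)| ^ r := by positivity
  exact Complex.ofReal_ne_zero.2 (by positivity)

/-! ### Exponentials and projections -/

/-- The symbol of `P_N`. -/
def projSymbol (N : ℕ) (k : ℤ) : ℂ := if k ∈ Finset.Icc (-(N : ℤ)) N then 1 else 0

theorem norm_projSymbol_le (N : ℕ) (k : ℤ) : ‖projSymbol N k‖ ≤ 1 := by
  rw [projSymbol]
  split_ifs <;> simp

/-- The projection `P_N` on `H^r`. -/
def projH {r : ℝ} (hr : 0 ≤ r) (N : ℕ) : HPer r →L[ℂ] HPer r :=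
  ((seqEquiv hr).symm.toContinuousLinearEquiv : _ →L[ℂ] HPer r) ∘L
    diag (norm_projSymbol_le N) ∘L ((seqEquiv hr).toContinuousLinearEquiv : HPer r →L[ℂ] _)

theorem coef_projH {r : ℝ} (hr : 0 ≤ r) (N : ℕ) (u : HPer r) (k : ℤ) :
    coef k (HPer.toL2 (projH hr N u)) = projSymbol N k * coef k (HPer.toL2 u) := by
  simp only [projH, ContinuousLinearMap.coe_comp, Function.comp_apply,
    ContinuousLinearEquiv.coe_coe, LinearIsometryEquiv.coe_toContinuousLinearEquiv,
    coef_seqEquiv_symm, diag_apply, seqEquiv_apply]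
  have h := weight_ne_zero r k
  field_simp

theorem norm_projH_le {r : ℝ} (hr : 0 ≤ r) (N : ℕ) : ‖projH hr N‖ ≤ 1 := by
  refine ContinuousLinearMap.opNorm_le_bound _ zero_le_one fun u => ?_
  have h := (diag (norm_projSymbol_le N)).le_of_opNorm_le (norm_diag_le (norm_projSymbol_le N))
    (seqEquiv hr u)
  rw [(seqEquiv hr).norm_map] at h
  refine le_trans (le_of_eq ?_) h
  exact (seqEquiv hr).symm.norm_map _

/-- The exponential `e^{ikx}` as an element of `H^r`. -/
def mode {r : ℝ} (hr : 0 ≤ r) (k : ℤ) : HPer r :=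
  (seqEquiv hr).symm (lp.single 2 k ((weight r k : ℝ) : ℂ))

theorem toL2_mode {r : ℝ} (hr : 0 ≤ r) (k : ℤ) :
    HPer.toL2 (mode hr k) = fourierLp (T := 2 * π) 2 k := by
  refine L2_ext fun j => ?_
  rw [mode, coef_seqEquiv_symm, coef_fourierLp, lp.single_apply]
  split_ifs with h
  · subst h
    rw [Pi.single_eq_same, inv_mul_cancel₀ (weight_ne_zero r j)]
  · rw [Pi.single_eq_of_ne h, mul_zero]

theorem coef_mode {r : ℝ} (hr : 0 ≤ r) (j k : ℤ) :
    coef j (HPer.toL2 (mode hr k)) = if j = k then 1 else 0 := by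
  rw [toL2_mode, coef_fourierLp]

theorem hasSum_mode {r : ℝ} (hr : 0 ≤ r) (u : HPer r) :
    HasSum (fun k => coef k (HPer.toL2 u) • mode hr k) u := by
  have h := (lp.hasSum_single (by norm_num) (seqEquiv hr u)).mapL
    ((seqEquiv hr).symm.toContinuousLinearEquiv : _ →L[ℂ] HPer r)
  simp only [ContinuousLinearEquiv.coe_coe, LinearIsometryEquiv.coe_toContinuousLinearEquiv,
    LinearIsometryEquiv.symm_apply_apply] at h
  refine h.congr_fun fun k => ?_
  rw [mode, ← map_smul, ← lp.single_smul, seqEquiv_apply, smul_eq_mul, mul_comm]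

theorem projH_eq_sum {r : ℝ} (hr : 0 ≤ r) (N : ℕ) (u : HPer r) :
    projH hr N u = ∑ k ∈ Finset.Icc (-(N : ℤ)) N, coef k (HPer.toL2 u) • mode hr k := by
  refine HPer_ext fun j => ?_
  simp only [coef_projH, map_sum, map_smul, coef_mode, smul_eq_mul, mul_ite, mul_one, mul_zero,
    Finset.sum_ite_eq, projSymbol, ite_mul, one_mul, zero_mul]

theorem tendsto_projH {r : ℝ} (hr : 0 ≤ r) (u : HPer r) :
    Tendsto (fun N => projH hr N u) atTop (𝓝 u) := by
  simp only [projH_eq_sum]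
  exact (hasSum_mode hr u).comp Finset.tendsto_Icc_neg

theorem toL2_projH {r : ℝ} (hr : 0 ≤ r) (N : ℕ) (u : HPer r) :
    HPer.toL2 (projH hr N u) = proj N (HPer.toL2 u) := by
  simp only [projH_eq_sum, map_sum, map_smul, toL2_mode, proj, coef_apply]

theorem mem_trigSpace_iff {N : ℕ} {f : L2} :
    f ∈ trigSpace N ↔ ∀ k, k ∉ Finset.Icc (-(N : ℤ)) N → coef k f = 0 := by
  constructor
  · intro hf k hk
    refine Submodule.span_induction (p := fun f _ => coef k f = 0) ?_ (map_zero _)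
      (fun f g _ _ h1 h2 => by rw [map_add, h1, h2, add_zero])
      (fun c f _ h => by rw [map_smul, h, smul_zero]) hf
    rintro _ ⟨j, hj, rfl⟩
    rw [coef_fourierLp, if_neg]
    rintro rfl
    exact hk (Finset.mem_Icc.2 hj)
  · intro hf
    have h : f = proj N f := by
      refine L2_ext fun j => ?_
      simp only [proj, map_sum, map_smul, coef_fourierLp, smul_eq_mul, mul_ite, mul_one, mul_zero,
        Finset.sum_ite_eq, ← coef_apply]
      split_ifs with hj
      · rfl
      · exact hf j hj
    rw [h, proj]
    exact Submodule.sum_mem _ fun k hk => Submodule.smul_mem _ _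
      (Submodule.subset_span ⟨k, Finset.mem_Icc.1 hk, rfl⟩)

theorem toL2_mem_trigSpace_iff {r : ℝ} (hr : 0 ≤ r) {N : ℕ} {u : HPer r} :
    HPer.toL2 u ∈ trigSpace N ↔ projH hr N u = u := by
  rw [mem_trigSpace_iff]
  constructor
  · intro h
    refine HPer_ext fun k => ?_
    rw [coef_projH, projSymbol]
    split_ifs with hk
    · rw [one_mul]
    · rw [h k hk, mul_zero]
  · intro h k hk
    rw [← h, coef_projH, projSymbol, if_neg hk, zero_mul]

theorem exists_lift_of_mem_trigSpace {r : ℝ} (hr : 0 ≤ r) {N : ℕ} {f : L2} (hf : f ∈ trigSpace N) :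
    ∃ u : HPer r, HPer.toL2 u = f := by
  refine ⟨∑ k ∈ Finset.Icc (-(N : ℤ)) N, coef k f • mode hr k, L2_ext fun j => ?_⟩
  simp only [map_sum, map_smul, coef_mode, smul_eq_mul, mul_ite, mul_one, mul_zero,
    Finset.sum_ite_eq]
  split_ifs with hj
  · rfl
  · exact (mem_trigSpace_iff.1 hf j hj).symm

/-! ### Multiplication -/

theorem summable_weight_inv_sq {r : ℝ} (hr : 1 ≤ r) :
    Summable fun k : ℤ => (weight r k)⁻¹ ^ (2 : ℝ) := by
  refine Summable.of_norm_bounded_eventually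
    (g := fun k : ℤ => 1 / (k : ℝ) ^ 2) (Real.summable_one_div_int_pow.2 (by norm_num)) ?_
  have h0 : ∀ᶠ k : ℤ in cofinite, k ≠ 0 := by
    simpa using (finite_singleton (0 : ℤ)).compl_mem_cofinite
  refine h0.mono fun k hk => ?_
  have hk' : 0 < |(k : ℝ)| := abs_pos.2 (Int.cast_ne_zero.2 hk)
  have hw := weight_pos r k
  rw [Real.rpow_two, Real.norm_of_nonneg (by positivity), inv_pow, one_div, ← sq_abs (k : ℝ)]
  gcongr
  exact abs_le_weight hr k

/-- Cauchy–Schwarz between the inverse weights, square-summable for `r ≥ 1`, and the weighted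
coefficients. This is the Sobolev embedding into continuous functions. -/
theorem summable_coef {r : ℝ} (hr : 1 ≤ r) (u : HPer r) :
    (Summable fun k => ‖coef k (HPer.toL2 u)‖) ∧ ∑' k, ‖coef k (HPer.toL2 u)‖ ≤
      (∑' k, (weight r k)⁻¹ ^ (2 : ℝ)) ^ (1 / 2 : ℝ) * ‖u‖ := by
  have hs := lp.hasSum_norm (p := 2) (by norm_num) (HPer.toSeq r u)
  simp only [ENNReal.toReal_ofNat] at hs
  have h := Real.summable_and_inner_le_Lp_mul_Lq_tsum_of_nonneg (p := 2) (q := 2)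
    Real.HolderConjugate.two_two (f := fun k => (weight r k)⁻¹) (g := fun k => ‖HPer.toSeq r u k‖)
    (fun k => (inv_pos.2 (weight_pos r k)).le) (fun k => norm_nonneg _)
    (summable_weight_inv_sq hr) hs.summable
  have e : ∀ k, (weight r k)⁻¹ * ‖HPer.toSeq r u k‖ = ‖coef k (HPer.toL2 u)‖ := fun k => by
    rw [toSeq_apply, norm_mul, Complex.norm_real, Real.norm_of_nonneg (weight_pos r k).le,
      inv_mul_cancel_left₀ (weight_pos r k).ne']
  simp only [e] at h
  refine ⟨h.1, h.2.trans (le_of_eq ?_)⟩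
  rw [hs.tsum_eq, ← Real.rpow_mul (norm_nonneg _)]
  norm_num
  -- What remains is that the norm of `HPer r` is, by definition, that of the weighted sequence.
  left
  rfl

theorem norm_coef_smul_fourier (c : ℂ) (k : ℤ) : ‖c • fourier (T := 2 * π) k‖ = ‖c‖ := by
  rw [norm_smul, fourier_norm, mul_one]

theorem summable_fourier_series {r : ℝ} (hr : 1 ≤ r) (u : HPer r) :
    Summable fun k => coef k (HPer.toL2 u) • fourier (T := 2 * π) k :=
  .of_norm (by simpa only [norm_coef_smul_fourier] using (summable_coef hr u).1)

/-- The continuous representative of an element of `H^r`, `r ≥ 1`. -/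
def toCont {r : ℝ} (hr : 1 ≤ r) : HPer r →L[ℂ] C(Torus, ℂ) :=
  LinearMap.mkContinuous
    { toFun := fun u => ∑' k, coef k (HPer.toL2 u) • fourier (T := 2 * π) k
      map_add' := fun u v => by
        rw [← (summable_fourier_series hr u).tsum_add (summable_fourier_series hr v)]
        simp only [map_add, add_smul]
      map_smul' := fun c u => by
        rw [RingHom.id_apply, ← (summable_fourier_series hr u).tsum_const_smul]
        simp only [map_smul, smul_assoc] }
    ((∑' k, (weight r k)⁻¹ ^ (2 : ℝ)) ^ (1 / 2 : ℝ)) fun u => by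
      refine (norm_tsum_le_tsum_norm ?_).trans ?_
      · simpa only [norm_coef_smul_fourier] using (summable_coef hr u).1
      · simpa only [norm_coef_smul_fourier] using (summable_coef hr u).2

/-- The Fourier series converges both uniformly and in `L²`, and the two limits must agree. -/
theorem toLp_toCont {r : ℝ} (hr : 1 ≤ r) (u : HPer r) :
    ContinuousMap.toLp 2 AddCircle.haarAddCircle ℂ (toCont hr u) = HPer.toL2 u := by
  have h1 := (summable_fourier_series hr u).hasSum.mapL
    (ContinuousMap.toLp (E := ℂ) 2 (AddCircle.haarAddCircle (T := 2 * π)) ℂ)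
  have h2 := hasSum_fourier_series_L2 (T := 2 * π) (HPer.toL2 u)
  refine HasSum.unique h1 ?_
  simpa only [map_smul, coef_apply] using! h2

theorem toCont_ae {r : ℝ} (hr : 1 ≤ r) (u : HPer r) :
    toCont hr u =ᵐ[AddCircle.haarAddCircle (T := 2 * π)] HPer.toL2 u := by
  rw [← toLp_toCont hr u]
  exact (ContinuousMap.coeFn_toLp _ _).symm

/-- Multiplication `H^r × L² → L²`, `r ≥ 1`. -/
def mulOp {r : ℝ} (hr : 1 ≤ r) : HPer r →L[ℂ] L2 →L[ℂ] L2 :=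
  ((ContinuousLinearMap.mul ℂ ℂ).holderL (AddCircle.haarAddCircle (T := 2 * π)) ∞ 2 2) ∘L
    ContinuousMap.toLp ∞ (AddCircle.haarAddCircle (T := 2 * π)) ℂ ∘L toCont hr

theorem mulOp_ae {r : ℝ} (hr : 1 ≤ r) (u : HPer r) (f : L2) :
    mulOp hr u f =ᵐ[AddCircle.haarAddCircle (T := 2 * π)] fun x => u x * f x := by
  have h1 := ContinuousLinearMap.coeFn_holder (r := 2) (ContinuousLinearMap.mul ℂ ℂ)
    (ContinuousMap.toLp ∞ (AddCircle.haarAddCircle (T := 2 * π)) ℂ (toCont hr u)) f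
  have h2 := ContinuousMap.coeFn_toLp (p := ∞) (AddCircle.haarAddCircle (T := 2 * π)) (𝕜 := ℂ)
    (toCont hr u)
  filter_upwards [h1, h2, toCont_ae hr u] with x hx1 hx2 hx3
  rw [← hx3, ← hx2]
  exact hx1

/-! ### Real-valued functions -/

theorem ae_volume_iff {p : Torus → Prop} :
    (∀ᵐ x : Torus, p x) ↔ ∀ᵐ x ∂(AddCircle.haarAddCircle (T := 2 * π)), p x := by
  rw [AddCircle.volume_eq_smul_haarAddCircle, Measure.ae_ennreal_smul_measure_iff]
  simpa using Real.pi_pos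

theorem coef_star (f : L2) (k : ℤ) : coef k (star f) = (starRingEnd ℂ) (coef (-k) f) := by
  rw [coef_apply, coef_apply, fourierCoeff, fourierCoeff, ← integral_conj]
  refine integral_congr_ae ?_
  filter_upwards [Lp.coeFn_star f] with x hx
  rw [hx, Pi.star_apply, smul_eq_mul, smul_eq_mul, map_mul, fourier_neg, neg_neg]
  rfl

theorem isRealValued_iff {f : L2} :
    IsRealValued f ↔ ∀ k, coef (-k) f = (starRingEnd ℂ) (coef k f) := by
  have h1 : IsRealValued f ↔ star f = f := by
    rw [IsRealValued, ae_volume_iff, Lp.ext_iff]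
    constructor
    · intro h
      filter_upwards [h, Lp.coeFn_star f] with x hx hs
      rw [hs]
      exact Complex.conj_eq_iff_im.2 hx
    · intro h
      filter_upwards [h, Lp.coeFn_star f] with x hx hs
      rw [hs] at hx
      exact Complex.conj_eq_iff_im.1 hx
  rw [h1]
  constructor
  · intro h k
    have h2 := coef_star f (-k)
    rwa [h, neg_neg] at h2
  · intro h
    refine L2_ext fun k => ?_
    rw [coef_star, h, Complex.conj_conj]

/-- The real-valued elements of `H^r`, as a real subspace. -/
def realSubspace (r : ℝ) : Submodule ℝ (HPer r) where
  carrier := {u | ∀ k, coef (-k) (HPer.toL2 u) = (starRingEnd ℂ) (coef k (HPer.toL2 u))}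
  zero_mem' k := by simp
  add_mem' hu hv k := by simp only [map_add, hu k, hv k]
  smul_mem' c u hu k := by
    have h : c • u = (c : ℂ) • u := rfl
    simp only [h, map_smul, smul_eq_mul, map_mul, hu k, Complex.conj_ofReal]

theorem mem_realSubspace_iff {r : ℝ} {u : HPer r} : u ∈ realSubspace r ↔ IsRealValued u :=
  isRealValued_iff.symm

theorem isClosed_realSubspace {r : ℝ} (hr : 0 ≤ r) :
    IsClosed (realSubspace r : Set (HPer r)) := by
  have e : (realSubspace r : Set (HPer r)) =
      ⋂ k, {u | coef (-k) (incl hr u) = (starRingEnd ℂ) (coef k (incl hr u))} := by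
    ext u
    simp only [mem_iInter, incl_apply]
    rfl
  rw [e]
  exact isClosed_iInter fun k => isClosed_eq
    ((coef (-k)).continuous.comp (incl hr).continuous)
    (Complex.continuous_conj.comp ((coef k).continuous.comp (incl hr).continuous))

theorem isRealValued_dx {r : ℝ} (hr : 1 ≤ r) {u : HPer r} (hu : u ∈ realSubspace r) :
    IsRealValued (dx hr u) := by
  refine isRealValued_iff.2 fun k => ?_
  rw [coef_dx, coef_dx, hu k]
  simp

theorem isRealValued_mulOp {r : ℝ} (hr : 1 ≤ r) {u : HPer r} (hu : u ∈ realSubspace r) {f : L2}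
    (hf : IsRealValued f) : IsRealValued (mulOp hr u f) := by
  have h1 := ae_volume_iff.1 (mem_realSubspace_iff.1 hu)
  have h2 := ae_volume_iff.1 hf
  refine ae_volume_iff.2 ?_
  filter_upwards [h1, h2, mulOp_ae hr u f] with x hx1 hx2 hx3
  rw [hx3, Complex.mul_im, hx1, hx2]
  ring

theorem projH_mem_realSubspace {r : ℝ} (hr : 0 ≤ r) (N : ℕ) {u : HPer r}
    (hu : u ∈ realSubspace r) : projH hr N u ∈ realSubspace r := by
  intro k
  rw [coef_projH, coef_projH, hu k, map_mul]
  congr 1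
  have h : -k ∈ Finset.Icc (-(N : ℤ)) N ↔ k ∈ Finset.Icc (-(N : ℤ)) N := by
    rw [Finset.mem_Icc, Finset.mem_Icc]
    omega
  simp only [projSymbol, h]
  split_ifs <;> simp

/-! ### The product rule -/

theorem eq_of_eq_mode {r : ℝ} (hr : 0 ≤ r) {Φ Ψ : HPer r →L[ℂ] ℂ}
    (h : ∀ k, Φ (mode hr k) = Ψ (mode hr k)) : Φ = Ψ := by
  ext u
  have h1 := (hasSum_mode hr u).mapL Φ
  have h2 := (hasSum_mode hr u).mapL Ψ
  simp only [map_smul, h] at h1 h2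
  exact h1.unique h2

theorem dx_mode {r : ℝ} (hr : 1 ≤ r) (k : ℤ) :
    dx hr (mode (zero_le_one.trans hr) k) =
      (Complex.I * k) • fourierLp (T := 2 * π) 2 k := by
  refine L2_ext fun j => ?_
  rw [coef_dx, coef_mode, map_smul, coef_fourierLp]
  split_ifs with h
  · rw [h, smul_eq_mul]
  · simp

theorem mulOp_mode {r : ℝ} (hr : 1 ≤ r) (j k : ℤ) :
    mulOp hr (mode (zero_le_one.trans hr) j) (fourierLp (T := 2 * π) 2 k) =
      fourierLp (T := 2 * π) 2 (j + k) := by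
  refine Lp.ext ?_
  have h := mulOp_ae hr (mode (zero_le_one.trans hr) j) (fourierLp (T := 2 * π) 2 k)
  rw [toL2_mode] at h
  filter_upwards [h, coeFn_fourierLp (T := 2 * π) 2 j, coeFn_fourierLp (T := 2 * π) 2 k,
    coeFn_fourierLp (T := 2 * π) 2 (j + k)] with x h1 h2 h3 h4
  rw [h1, h2, h3, h4, fourier_add]

/-- Both sides are bounded and bilinear in `(u, v)`, and exponentials span a dense subspace of
`H^r`; for two exponentials the claim is additivity of frequencies. -/
theorem coef_deriv_mul {r : ℝ} (hr : 1 ≤ r) (u v : HPer r) (k : ℤ) :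
    coef k (mulOp hr u (dx hr v) + mulOp hr v (dx hr u)) =
      Complex.I * k * coef k (mulOp hr u (HPer.toL2 v)) := by
  have hr0 : 0 ≤ r := zero_le_one.trans hr
  have key : ∀ (v : HPer r), coef k ∘L ((mulOp hr).flip (dx hr v) + mulOp hr v ∘L dx hr) =
      (Complex.I * k) • (coef k ∘L (mulOp hr).flip (incl hr0 v)) := by
    intro v
    refine eq_of_eq_mode hr0 fun j => ?_
    have h2 : coef k ∘L (mulOp hr (mode hr0 j) ∘L dx hr
          + (mulOp hr).flip (dx hr (mode hr0 j))) =
        (Complex.I * k) • (coef k ∘L mulOp hr (mode hr0 j) ∘L incl hr0) := by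
      refine eq_of_eq_mode hr0 fun l => ?_
      simp only [ContinuousLinearMap.coe_comp, Function.comp_apply, add_apply,
        ContinuousLinearMap.flip_apply, dx_mode, map_smul, mulOp_mode,
        smul_apply, incl_apply, toL2_mode, map_add, coef_fourierLp,
        smul_eq_mul, add_comm l j]
      split_ifs with h
      · subst h
        push_cast
        ring
      · simp
    exact DFunLike.congr_fun h2 v
  have h := DFunLike.congr_fun (key v) u
  simpa only [ContinuousLinearMap.coe_comp, Function.comp_apply, add_apply,
    ContinuousLinearMap.flip_apply, smul_apply, incl_apply, smul_eq_mul] using h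

/-- Integration by parts through Parseval. The derivative of `g` is prescribed by coefficients, so
that `g` may be a product known only to lie in `L²`. -/
theorem inner_dx_eq {r : ℝ} (hr : 1 ≤ r) (φ : HPer r) {g g' : L2}
    (h : ∀ k : ℤ, coef k g' = Complex.I * k * coef k g) :
    ⟪dx hr φ, g⟫_ℂ = -⟪HPer.toL2 φ, g'⟫_ℂ := by
  refine HasSum.unique (hasSum_inner (dx hr φ) g) ?_
  refine (hasSum_inner (HPer.toL2 φ) g').neg.congr_fun fun k => ?_
  rw [coef_dx, h, map_mul, map_mul, Complex.conj_I, map_intCast]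
  ring

theorem inner_frac_eq {r : ℝ} (hr : 0 ≤ r) (φ v : HPer r) :
    ⟪frac hr φ, HPer.toL2 v⟫_ℂ = ⟪HPer.toL2 φ, frac hr v⟫_ℂ := by
  refine HasSum.unique (hasSum_inner (frac hr φ) (HPer.toL2 v)) ?_
  refine (hasSum_inner (HPer.toL2 φ) (frac hr v)).congr_fun fun k => ?_
  rw [coef_frac, coef_frac, map_mul, Complex.conj_ofReal]
  ring

/-! ### The vector field -/

/-- `u_x + u u_x`. -/
def transport {r : ℝ} (hr : 1 ≤ r) (u : HPer r) : L2 := dx hr u + mulOp hr u (dx hr u)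

/-- The field `-(1 + 𝒟^r)⁻¹ (u_x + u u_x)` of the fractional BBM equation. -/
def field {r : ℝ} (hr : 1 ≤ r) (u : HPer r) : HPer r :=
  -resolvent (zero_le_one.trans hr) (transport hr u)

theorem coef_field {r : ℝ} (hr : 1 ≤ r) (u : HPer r) (k : ℤ) :
    ((1 + |(k : ℝ)| ^ r : ℝ) : ℂ) * coef k (HPer.toL2 (field hr u)) =
      -coef k (transport hr u) := by
  rw [field, map_neg, map_neg, coef_resolvent, mul_neg,
    mul_inv_cancel_left₀ (resolvent_symbol_ne_zero r k)]

theorem field_zero {r : ℝ} (hr : 1 ≤ r) : field hr 0 = 0 := by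
  simp [field, transport]

/-- The nonlinearity is quadratic: `u u_x - v v_x = (u - v) u_x + v (u - v)_x`, and multiplication
`H^r × L² → L²` is bounded. -/
theorem lipschitzOnWith_field {r : ℝ} (hr : 1 ≤ r) (R : ℝ) :
    ∃ K : ℝ≥0, LipschitzOnWith K (field hr) (Metric.closedBall 0 R) := by
  set J := resolvent (zero_le_one.trans hr)
  refine ⟨‖J‖₊ * (‖dx hr‖₊ + (‖mulOp hr‖₊ * ‖dx hr‖₊ * R.toNNReal
    + ‖mulOp hr‖₊ * R.toNNReal * ‖dx hr‖₊)), LipschitzOnWith.of_dist_le_mul fun u hu v hv => ?_⟩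
  rw [mem_closedBall_zero_iff] at hu hv
  have hR : 0 ≤ R := (norm_nonneg _).trans hu
  have e : field hr u - field hr v = -J (dx hr (u - v) +
      (mulOp hr (u - v) (dx hr u) + mulOp hr v (dx hr (u - v)))) := by
    simp only [field, transport, map_sub, map_add, sub_apply]
    abel
  rw [dist_eq_norm, dist_eq_norm, e, norm_neg]
  push_cast
  rw [Real.coe_toNNReal _ hR, mul_assoc]
  refine J.le_opNorm_of_le ?_
  have h1 : ‖dx hr (u - v)‖ ≤ ‖dx hr‖ * ‖u - v‖ := (dx hr).le_opNorm _
  have h2 : ‖mulOp hr (u - v) (dx hr u)‖ ≤ ‖mulOp hr‖ * ‖u - v‖ * (‖dx hr‖ * R) :=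
    (mulOp hr).le_of_opNorm₂_le_of_le le_rfl le_rfl ((dx hr).le_opNorm_of_le hu)
  have h3 : ‖mulOp hr v (dx hr (u - v))‖ ≤ ‖mulOp hr‖ * R * (‖dx hr‖ * ‖u - v‖) :=
    (mulOp hr).le_of_opNorm₂_le_of_le le_rfl hv h1
  calc _ ≤ _ := norm_add_le_of_le h1 (norm_add_le_of_le h2 h3)
    _ = _ := by ring

theorem field_mem_realSubspace {r : ℝ} (hr : 1 ≤ r) {u : HPer r} (hu : u ∈ realSubspace r) :
    field hr u ∈ realSubspace r := by
  refine neg_mem fun k => ?_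
  have h := isRealValued_iff.1 (isRealValued_mulOp hr hu (isRealValued_dx hr hu)) k
  have h' := isRealValued_iff.1 (isRealValued_dx hr hu) k
  rw [coef_resolvent, coef_resolvent, transport, map_add, map_add, h, h', map_mul, map_add,
    map_inv₀, Complex.conj_ofReal, Int.cast_neg, abs_neg]

/-- The equation `u_t + u_x + u u_x + 𝒟^r u_t = 0` as an ordinary differential equation. -/
theorem eqn_iff {r : ℝ} (hr : 1 ≤ r) (u v : HPer r) :
    (∀ᵐ x : Torus, v x + deriv_x (HPer.toL2 u) x + u x * deriv_x (HPer.toL2 u) x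
      + fracLap r (HPer.toL2 v) x = 0) ↔ v = field hr u := by
  have hr0 : 0 ≤ r := zero_le_one.trans hr
  have h1 : (∀ᵐ x : Torus, v x + deriv_x (HPer.toL2 u) x + u x * deriv_x (HPer.toL2 u) x
      + fracLap r (HPer.toL2 v) x = 0) ↔
      HPer.toL2 v + dx hr u + mulOp hr u (dx hr u) + frac hr0 v = 0 := by
    rw [ae_volume_iff, Lp.ext_iff, ← dx_apply hr, ← frac_apply hr0]
    have e1 := Lp.coeFn_add (HPer.toL2 v + dx hr u + mulOp hr u (dx hr u)) (frac hr0 v)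
    have e2 := Lp.coeFn_add (HPer.toL2 v + dx hr u) (mulOp hr u (dx hr u))
    have e3 := Lp.coeFn_add (HPer.toL2 v) (dx hr u)
    have e4 := Lp.coeFn_zero ℂ 2 (AddCircle.haarAddCircle (T := 2 * π))
    refine eventually_congr ?_
    filter_upwards [e1, e2, e3, e4, mulOp_ae hr u (dx hr u)] with x h1 h2 h3 h4 h5
    rw [h1, h4, Pi.add_apply, h2, Pi.add_apply, h3, Pi.add_apply, h5, Pi.zero_apply]
  rw [h1]
  have h2 : ∀ k, coef k (HPer.toL2 v + dx hr u + mulOp hr u (dx hr u) + frac hr0 v) =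
      ((1 + |(k : ℝ)| ^ r : ℝ) : ℂ) *
        (coef k (HPer.toL2 v) - coef k (HPer.toL2 (field hr u))) := by
    intro k
    rw [mul_sub, coef_field, transport]
    simp only [map_add, coef_frac]
    push_cast
    ring
  constructor
  · intro h
    refine HPer_ext fun k => ?_
    have h3 := h2 k
    rw [h, map_zero] at h3
    exact sub_eq_zero.1 ((mul_eq_zero.1 h3.symm).resolve_left (resolvent_symbol_ne_zero r k))
  · intro h
    refine L2_ext fun k => ?_
    rw [h2, ← h, sub_self, mul_zero, map_zero]

/-! ### The Galerkin equation -/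

theorem pairing_eq_inner {f : Torus → ℂ} {F : L2} (hf : ∀ᵐ x : Torus, f x = F x) (g : L2) :
    pairing f g = 2 * π * ⟪g, F⟫_ℂ := by
  have h1 : pairing f g = ∫ x : Torus, F x * (starRingEnd ℂ) (g x) :=
    integral_congr_ae (hf.mono fun x hx => by simp only [hx])
  have h2 := AddCircle.integral_haarAddCircle (T := 2 * π)
    (f := fun x : Torus => F x * (starRingEnd ℂ) (g x))
  rw [h1, L2.inner_def]
  simp only [RCLike.inner_apply]
  rw [h2, Complex.real_smul]
  push_cast
  have : (π : ℂ) ≠ 0 := Complex.ofReal_ne_zero.2 Real.pi_ne_zero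
  field_simp

theorem flux_ae {r : ℝ} (hr : 1 ≤ r) (u : HPer r) :
    ∀ᵐ x : Torus, flux 1 (1 / 3) u x =
      (HPer.toL2 u + (1 / 2 : ℂ) • mulOp hr u (HPer.toL2 u) : L2) x := by
  refine ae_volume_iff.2 ?_
  filter_upwards [Lp.coeFn_add (HPer.toL2 u) ((1 / 2 : ℂ) • mulOp hr u (HPer.toL2 u)),
    Lp.coeFn_smul (1 / 2 : ℂ) (mulOp hr u (HPer.toL2 u)), mulOp_ae hr u (HPer.toL2 u)]
    with x h1 h2 h3
  rw [h1, Pi.add_apply, h2, Pi.smul_apply, h3, flux, smul_eq_mul]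
  push_cast
  ring

theorem galerkin_residual {r : ℝ} (hr : 1 ≤ r) (u v φ : HPer r) :
    pairing v φ + pairing v (fracLap r (HPer.toL2 φ))
      - pairing (flux 1 (1 / 3) u) (deriv_x (HPer.toL2 φ)) =
    2 * π * ⟪HPer.toL2 φ, HPer.toL2 v + frac (zero_le_one.trans hr) v + transport hr u⟫_ℂ := by
  have hr0 : 0 ≤ r := zero_le_one.trans hr
  have h1 : ⟪dx hr φ, HPer.toL2 u + (1 / 2 : ℂ) • mulOp hr u (HPer.toL2 u)⟫_ℂ =
      -⟪HPer.toL2 φ, transport hr u⟫_ℂ := by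
    refine inner_dx_eq hr φ fun k => ?_
    have h := coef_deriv_mul hr u u k
    rw [transport]
    simp only [map_add, map_smul, smul_eq_mul, coef_dx] at h ⊢
    -- The product rule with both factors `u` says `2 u u_x = (u²)_x`.
    linear_combination (1 / 2 : ℂ) * h
  rw [pairing_eq_inner (F := HPer.toL2 v) (.of_forall fun _ => rfl),
    pairing_eq_inner (F := HPer.toL2 v) (.of_forall fun _ => rfl),
    pairing_eq_inner (flux_ae hr u), ← frac_apply hr0, ← dx_apply hr, h1, inner_frac_eq,
    inner_add_right, inner_add_right]
  ring

/-- The scheme says that the residual `v + 𝒟^r v + u_x + u u_x` is orthogonal to `V_N`. Its `k`-th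
coefficient is `1 + |k|^r` times the difference of those of `v` and `field hr u`, so testing with
exponentials decides the modes `|k| ≤ N`; the others vanish since `v` lies in `V_N`. -/
theorem galerkin_iff {r : ℝ} (hr : 1 ≤ r) {N : ℕ} (u v : HPer r)
    (hv : HPer.toL2 v ∈ trigSpace N) :
    (∀ φ ∈ trigSpace N, pairing v φ + pairing v (fracLap r φ) =
      pairing (flux 1 (1 / 3) u) (deriv_x φ)) ↔
    v = projH (zero_le_one.trans hr) N (field hr u) := by
  have hr0 : 0 ≤ r := zero_le_one.trans hr
  have hc : ∀ k, coef k (HPer.toL2 v + frac hr0 v + transport hr u) =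
      ((1 + |(k : ℝ)| ^ r : ℝ) : ℂ) *
        (coef k (HPer.toL2 v) - coef k (HPer.toL2 (field hr u))) := by
    intro k
    rw [mul_sub, coef_field]
    simp only [map_add, coef_frac]
    push_cast
    ring
  have h2π : (2 * π : ℂ) ≠ 0 := mul_ne_zero two_ne_zero (Complex.ofReal_ne_zero.2 Real.pi_ne_zero)
  constructor
  · intro h
    refine HPer_ext fun k => ?_
    rw [coef_projH, projSymbol]
    split_ifs with hk
    · have hφ : HPer.toL2 (mode hr0 k) ∈ trigSpace N := by
        rw [toL2_mode]
        exact Submodule.subset_span ⟨k, Finset.mem_Icc.1 hk, rfl⟩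
      have h3 := galerkin_residual hr u v (mode hr0 k)
      rw [h _ hφ, sub_self] at h3
      have h4 := (mul_eq_zero.1 h3.symm).resolve_left h2π
      rw [toL2_mode] at h4
      have h5 : coef k (HPer.toL2 v + frac hr0 v + transport hr u) = 0 := h4
      rw [hc] at h5
      rw [one_mul]
      exact sub_eq_zero.1 ((mul_eq_zero.1 h5).resolve_left (resolvent_symbol_ne_zero r k))
    · rw [zero_mul]
      exact mem_trigSpace_iff.1 hv k hk
  · intro h φ hφ
    obtain ⟨Φ, rfl⟩ := exists_lift_of_mem_trigSpace hr0 hφ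
    rw [← sub_eq_zero]
    refine (galerkin_residual hr u v Φ).trans ?_
    rw [(hasSum_inner _ _).unique (a₂ := 0), mul_zero]
    refine hasSum_zero.congr_fun fun k => ?_
    rw [hc]
    by_cases hk : k ∈ Finset.Icc (-(N : ℤ)) N
    · rw [h, coef_projH, projSymbol, if_pos hk, one_mul, sub_self, mul_zero, mul_zero]
    · rw [mem_trigSpace_iff.1 hφ k hk, map_zero, zero_mul]

/-! ### Energy -/

/-- For real `u`, `X = ∫ u² u_x` can be integrated by parts to give `X = -2X`. -/
theorem inner_mulOp_dx_self {r : ℝ} (hr : 1 ≤ r) {u : HPer r} (hu : u ∈ realSubspace r) :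
    ⟪HPer.toL2 u, mulOp hr u (dx hr u)⟫_ℂ = 0 := by
  have h1 : ⟪dx hr u, mulOp hr u (HPer.toL2 u)⟫_ℂ = ⟪HPer.toL2 u, mulOp hr u (dx hr u)⟫_ℂ := by
    rw [L2.inner_def, L2.inner_def]
    refine integral_congr_ae ?_
    filter_upwards [mulOp_ae hr u (HPer.toL2 u), mulOp_ae hr u (dx hr u),
      ae_volume_iff.1 (isRealValued_dx hr hu), ae_volume_iff.1 (mem_realSubspace_iff.1 hu)]
      with x h1 h2 h3 h4
    rw [h1, h2, RCLike.inner_apply, RCLike.inner_apply, Complex.conj_eq_iff_im.2 h3,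
      Complex.conj_eq_iff_im.2 h4]
    ring
  have h2 := inner_dx_eq hr u (coef_deriv_mul hr u u)
  rw [h1, inner_add_right] at h2
  linear_combination (1 / 3 : ℂ) * h2

theorem re_inner_dx {r : ℝ} (hr : 1 ≤ r) (u : HPer r) :
    (⟪HPer.toL2 u, dx hr u⟫_ℂ).re = 0 := by
  have h := congrArg Complex.re (inner_dx_eq hr u (coef_dx hr u))
  rw [← inner_conj_symm, Complex.conj_re, Complex.neg_re] at h
  linarith

/-- The energy form `Re (u, (1 + 𝒟^r) v)`. -/
def energy {r : ℝ} (hr : 0 ≤ r) : HPer r →L[ℝ] HPer r →L[ℝ] ℝ :=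
  LinearMap.mkContinuous₂
    (LinearMap.mk₂ ℝ (fun u v => (⟪incl hr u, incl hr v + frac hr v⟫_ℂ).re)
      (fun u u' v => by rw [map_add, inner_add_left, Complex.add_re])
      (fun c u v => by
        have h : c • u = (c : ℂ) • u := rfl
        rw [h, map_smul, inner_smul_left, Complex.conj_ofReal, Complex.re_ofReal_mul, smul_eq_mul])
      (fun u v v' => by
        rw [← Complex.add_re, ← inner_add_right, map_add, map_add, add_add_add_comm])
      (fun c u v => by
        have h : c • v = (c : ℂ) • v := rfl
        rw [h, map_smul, map_smul, ← smul_add, inner_smul_right, Complex.re_ofReal_mul,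
          smul_eq_mul]))
    (‖incl hr‖ * (‖incl hr‖ + ‖frac hr‖)) fun u v => by
      refine (Complex.abs_re_le_norm _).trans ((norm_inner_le_norm _ _).trans ?_)
      calc ‖incl hr u‖ * ‖incl hr v + frac hr v‖
          ≤ (‖incl hr‖ * ‖u‖) * (‖incl hr‖ * ‖v‖ + ‖frac hr‖ * ‖v‖) := by
            gcongr
            · exact (incl hr).le_opNorm u
            · exact norm_add_le_of_le ((incl hr).le_opNorm v) ((frac hr).le_opNorm v)
        _ = _ := by ring

theorem energy_apply {r : ℝ} (hr : 0 ≤ r) (u v : HPer r) :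
    energy hr u v = (⟪HPer.toL2 u, HPer.toL2 v + frac hr v⟫_ℂ).re := by
  rw [← incl_apply hr, ← incl_apply hr]
  rfl

theorem energy_symm {r : ℝ} (hr : 0 ≤ r) (u v : HPer r) : energy hr u v = energy hr v u := by
  rw [energy_apply, energy_apply, inner_add_right, inner_add_right, ← inner_frac_eq,
    ← inner_conj_symm (HPer.toL2 u), ← inner_conj_symm (frac hr u), Complex.add_re,
    Complex.add_re, Complex.conj_re, Complex.conj_re]

/-- Since `u` is in `V_N` the projection drops out, and `1 + 𝒟^r` cancels the resolvent. What
remains pairs `u` with `a u_x + a² u u_x`; each term contributes zero, whatever the real number `a`.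
-/
theorem energy_projH_field {r : ℝ} (hr : 1 ≤ r) {N : ℕ} {u : HPer r} (hu : u ∈ realSubspace r)
    (huN : projH (zero_le_one.trans hr) N u = u) (a : ℝ) :
    energy (zero_le_one.trans hr) u
      (projH (zero_le_one.trans hr) N (field hr (a • u))) = 0 := by
  have hr0 : 0 ≤ r := zero_le_one.trans hr
  have ht : transport hr (a • u) = (a : ℂ) • dx hr u + (a : ℂ) ^ 2 • mulOp hr u (dx hr u) := by
    have h : a • u = (a : ℂ) • u := rfl
    rw [transport, h, map_smul, map_smul, map_smul, smul_apply,
      smul_smul, sq]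
  have h1 : ⟪HPer.toL2 u, HPer.toL2 (projH hr0 N (field hr (a • u)))
      + frac hr0 (projH hr0 N (field hr (a • u)))⟫_ℂ =
      -⟪HPer.toL2 u, transport hr (a • u)⟫_ℂ := by
    refine HasSum.unique (hasSum_inner _ _) ?_
    refine (hasSum_inner (HPer.toL2 u) (transport hr (a • u))).neg.congr_fun fun k => ?_
    rw [map_add, coef_frac, coef_projH]
    have h := coef_field hr (a • u) k
    by_cases hk : k ∈ Finset.Icc (-(N : ℤ)) N
    · rw [projSymbol, if_pos hk]
      push_cast at h
      linear_combination (starRingEnd ℂ) (coef k (HPer.toL2 u)) * h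
    · rw [mem_trigSpace_iff.1 ((toL2_mem_trigSpace_iff hr0).2 huN) k hk]
      simp
  rw [energy_apply, h1, ht, inner_add_right, inner_smul_right, inner_smul_right,
    inner_mulOp_dx_self hr hu, mul_zero, add_zero, Complex.neg_re, Complex.re_ofReal_mul, re_inner_dx,
    mul_zero, neg_zero]

theorem hasSum_norm_sq {r : ℝ} (u : HPer r) :
    HasSum (fun k : ℤ => (1 + (k : ℝ) ^ 2) ^ r * ‖coef k (HPer.toL2 u)‖ ^ 2) (‖u‖ ^ 2) := by
  have h := lp.hasSum_norm (p := 2) (by norm_num) (HPer.toSeq r u)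
  simp only [ENNReal.toReal_ofNat, Real.rpow_two, toSeq_apply, norm_mul, mul_pow,
    Complex.norm_real, Real.norm_of_nonneg (weight_pos r _).le, weight_sq] at h
  exact h

/-- The energy dominates the plain `ℓ²` norm of the coefficients, and only frequencies `|k| ≤ N`
occur, where the Sobolev weight is at most `(1 + N²)^r`. -/
theorem norm_sq_le_energy {r : ℝ} (hr : 0 ≤ r) {N : ℕ} {u : HPer r} (huN : projH hr N u = u) :
    ‖u‖ ^ 2 ≤ (1 + (N : ℝ) ^ 2) ^ r * energy hr u u := by
  have h1 := hasSum_inner (HPer.toL2 u) (HPer.toL2 u + frac hr u)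
  have h2 := (Complex.reCLM.hasSum h1).mul_left ((1 + (N : ℝ) ^ 2) ^ r)
  rw [energy_apply]
  refine hasSum_le (fun k => ?_) (hasSum_norm_sq u) h2
  have h3 : (starRingEnd ℂ) (coef k (HPer.toL2 u)) * coef k (HPer.toL2 u + frac hr u) =
      (((1 + |(k : ℝ)| ^ r) * ‖coef k (HPer.toL2 u)‖ ^ 2 : ℝ) : ℂ) := by
    have h := Complex.conj_mul' (coef k (HPer.toL2 u))
    rw [map_add, coef_frac]
    push_cast
    rw [← h]
    ring
  rw [Complex.reCLM_apply, h3, Complex.ofReal_re]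
  by_cases hk : k ∈ Finset.Icc (-(N : ℤ)) N
  · have hk' : (k : ℝ) ^ 2 ≤ (N : ℝ) ^ 2 := by
      rw [Finset.mem_Icc] at hk
      exact sq_le_sq' (by exact_mod_cast hk.1) (by exact_mod_cast hk.2)
    refine mul_le_mul (Real.rpow_le_rpow (by positivity) (by linarith) hr) ?_ (by positivity)
      (by positivity)
    have : 0 ≤ |(k : ℝ)| ^ r * ‖coef k (HPer.toL2 u)‖ ^ 2 := by positivity
    linarith
  · rw [mem_trigSpace_iff.1 ((toL2_mem_trigSpace_iff hr).2 huN) k hk]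
    simp

theorem l2Norm_le {r : ℝ} (hr : 0 ≤ r) (u : HPer r) : l2Norm u ≤ √(2 * π) * ‖u‖ := by
  have h1 := AddCircle.integral_haarAddCircle (T := 2 * π) (f := fun x : Torus => ‖u x‖ ^ 2)
  have h2 := hasSum_sq_fourierCoeff (T := 2 * π) (HPer.toL2 u)
  have h3 : (∫ x : Torus, ‖u x‖ ^ 2) =
      2 * π * ∫ x, ‖u x‖ ^ 2 ∂(AddCircle.haarAddCircle (T := 2 * π)) := by
    rw [h1, smul_eq_mul]
    field_simp
  rw [l2Norm, h3, ← Real.sqrt_sq (norm_nonneg u), ← Real.sqrt_mul (by positivity)]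
  refine Real.sqrt_le_sqrt (mul_le_mul_of_nonneg_left ?_ (by positivity))
  refine hasSum_le (fun k => ?_) h2 (hasSum_norm_sq u)
  rw [coef_apply]
  exact le_mul_of_one_le_left (by positivity)
    (Real.one_le_rpow (by nlinarith [sq_nonneg (k : ℝ)]) hr)

/-! ### Solutions -/

/-! ### Fields on invariant subspaces -/

section Restriction

variable {X : Type*} [NormedAddCommGroup X] [NormedSpace ℝ X]

/-- A field that preserves a subspace, as a field on that subspace. -/
def restrictField (S : Submodule ℝ X) {G : X → X} (hS : ∀ x ∈ S, G x ∈ S) (x : S) : S :=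
  ⟨G x, hS x x.2⟩

theorem lipschitzOnWith_restrictField (S : Submodule ℝ X) {G : X → X} (hS : ∀ x ∈ S, G x ∈ S)
    (hG : ∀ R : ℝ, ∃ K : ℝ≥0, LipschitzOnWith K G (Metric.closedBall 0 R)) (R : ℝ) :
    ∃ K : ℝ≥0, LipschitzOnWith K (restrictField S hS) (Metric.closedBall 0 R) := by
  obtain ⟨K, hK⟩ := hG R
  refine ⟨K, LipschitzOnWith.of_dist_le_mul fun x hx y hy => ?_⟩
  exact hK.dist_le_mul x (by simpa using hx) y (by simpa using hy)

theorem hasDerivWithinAt_coe {S : Submodule ℝ X} {u : ℝ → S} {v : S} {s : Set ℝ} {t : ℝ}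
    (h : HasDerivWithinAt u v s t) : HasDerivWithinAt (fun t => (u t : X)) v s t :=
  S.subtypeL.hasFDerivAt.comp_hasDerivWithinAt t h

theorem contDiffOn_one_of_hasDerivWithinAt {u u' : ℝ → X} {s : Set ℝ} (hs : UniqueDiffOn ℝ s)
    (h : ∀ t ∈ s, HasDerivWithinAt u (u' t) s t) (hc : ContinuousOn u' s) : ContDiffOn ℝ 1 u s :=
  (contDiffOn_one_iff_derivWithin hs).2 ⟨fun t ht => (h t ht).differentiableWithinAt,
    hc.congr fun t ht => (h t ht).derivWithin (hs t ht)⟩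

end Restriction

variable {r : ℝ}

theorem continuous_field (hr : 1 ≤ r) : Continuous (field hr) := by
  rw [← continuousOn_univ]
  intro u _
  obtain ⟨K, hK⟩ := lipschitzOnWith_field hr (‖u‖ + 1)
  refine (hK.continuousOn.continuousAt ?_).continuousWithinAt
  refine mem_of_superset (Metric.ball_mem_nhds u one_pos) fun v hv => ?_
  rw [mem_closedBall_zero_iff]
  rw [Metric.mem_ball, dist_eq_norm] at hv
  linarith [norm_le_norm_sub_add v u, norm_sub_rev v u]

theorem lipschitzOnWith_projH_field (hr : 1 ≤ r) (N : ℕ) {K : ℝ≥0} {s : Set (HPer r)}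
    (h : LipschitzOnWith K (field hr) s) :
    LipschitzOnWith K (fun u => projH (zero_le_one.trans hr) N (field hr u)) s := by
  refine LipschitzOnWith.of_dist_le_mul fun u hu v hv => ?_
  rw [dist_eq_norm, ← map_sub]
  refine ((projH _ N).le_of_opNorm_le (norm_projH_le _ N) _).trans ?_
  rw [one_mul, ← dist_eq_norm]
  exact h.dist_le_mul u hu v hv

theorem isFSGSolution_iff (hr : 1 ≤ r) {N : ℕ} {u₀ : HPer r} {u : ℝ → HPer r} :
    IsFSGSolution 1 (1 / 3) 0 r N u₀ u ↔ (∀ t ∈ Ici (0 : ℝ), u t ∈ realSubspace r) ∧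
      (∀ t ∈ Ici (0 : ℝ), projH (zero_le_one.trans hr) N (u t) = u t) ∧
      u 0 = projH (zero_le_one.trans hr) N u₀ ∧
      ∀ t ∈ Ici (0 : ℝ),
        HasDerivWithinAt u (projH (zero_le_one.trans hr) N (field hr (u t))) (Ici 0) t := by
  have hr0 : 0 ≤ r := zero_le_one.trans hr
  -- A curve in the range of the bounded projection has its derivative there too, by uniqueness of
  -- derivatives.
  have hproj : ∀ {v : ℝ → HPer r} {v' : HPer r} {t : ℝ}, t ∈ Ici (0 : ℝ) →
      (∀ s ∈ Ici (0 : ℝ), projH hr0 N (v s) = v s) → HasDerivWithinAt v v' (Ici 0) t →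
      projH hr0 N v' = v' := by
    intro v v' t ht hv h
    have h1 := ((projH hr0 N).restrictScalars ℝ).hasFDerivAt.comp_hasDerivWithinAt t h
    exact (uniqueDiffOn_Ici (0 : ℝ) t ht).eq_deriv _
      (h1.congr (fun s hs => (hv s hs).symm) (hv t ht).symm) h
  -- With `κ₂ = 0` the Camassa–Holm terms disappear.
  have hcancel : ∀ a b c : ℂ, (a = b - ((0 : ℝ) : ℂ) * c) ↔ a = b := by simp
  constructor
  · intro h
    have hP : ∀ t ∈ Ici (0 : ℝ), projH hr0 N (u t) = u t := fun t ht =>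
      (toL2_mem_trigSpace_iff hr0).1 (h.mem t ht)
    refine ⟨fun t ht => mem_realSubspace_iff.2 (h.real t ht), hP, ?_, fun t ht => ?_⟩
    · exact Subtype.ext (h.init.trans (toL2_projH hr0 N u₀).symm)
    · have hd := ((h.contDiffOn.differentiableOn one_ne_zero) t ht).hasDerivWithinAt
      have hm := (toL2_mem_trigSpace_iff hr0).2 (hproj ht hP hd)
      rwa [(galerkin_iff hr (u t) _ hm).1 fun φ hφ => (hcancel _ _ _).1 (h.galerkin t ht φ hφ)]
        at hd
  · rintro ⟨hreal, hP, hinit, hd⟩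
    have hder : ∀ t ∈ Ici (0 : ℝ), derivWithin u (Ici 0) t = projH hr0 N (field hr (u t)) :=
      fun t ht => (hd t ht).derivWithin (uniqueDiffOn_Ici 0 t ht)
    refine ⟨contDiffOn_one_of_hasDerivWithinAt (uniqueDiffOn_Ici 0) hd ?_,
      fun t ht => mem_realSubspace_iff.1 (hreal t ht),
      fun t ht => (toL2_mem_trigSpace_iff hr0).2 (hP t ht), by rw [hinit, toL2_projH],
      fun t ht φ hφ => (hcancel _ _ _).2 ?_⟩
    · exact ((projH hr0 N).continuous.comp (continuous_field hr)).comp_continuousOn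
        fun t ht => (hd t ht).continuousWithinAt
    · refine (galerkin_iff hr (u t) _ ((toL2_mem_trigSpace_iff hr0).2 ?_)).2 (hder t ht) φ hφ
      exact hproj ht hP (hder t ht ▸ hd t ht)

theorem isFBBMSolution_iff (hr : 1 ≤ r) {T : ℝ} (hT : 0 < T) {u₀ : HPer r} {u : ℝ → HPer r} :
    IsFBBMSolution r T u₀ u ↔ (∀ t ∈ Icc 0 T, u t ∈ realSubspace r) ∧ u 0 = u₀ ∧
      ∀ t ∈ Icc 0 T, HasDerivWithinAt u (field hr (u t)) (Icc 0 T) t := by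
  constructor
  · intro h
    refine ⟨fun t ht => mem_realSubspace_iff.2 (h.real t ht), h.init, fun t ht => ?_⟩
    have hd := ((h.contDiffOn.differentiableOn one_ne_zero) t ht).hasDerivWithinAt
    rwa [(eqn_iff hr _ _).1 (h.eqn t ht)] at hd
  · rintro ⟨hreal, hinit, hd⟩
    refine ⟨contDiffOn_one_of_hasDerivWithinAt (uniqueDiffOn_Icc hT) hd ?_,
      fun t ht => mem_realSubspace_iff.1 (hreal t ht), hinit, fun t ht => ?_⟩
    · exact (continuous_field hr).comp_continuousOn fun t ht => (hd t ht).continuousWithinAt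
    · exact (eqn_iff hr _ _).2 ((hd t ht).derivWithin (uniqueDiffOn_Icc hT t ht))

theorem exists_isFSGSolution (hr : 1 ≤ r) (N : ℕ) {u₀ : HPer r} (hu₀ : u₀ ∈ realSubspace r) :
    ∃ u : ℝ → HPer r, IsFSGSolution 1 (1 / 3) 0 r N u₀ u := by
  have hr0 : 0 ≤ r := zero_le_one.trans hr
  have := completeSpace_HPer hr0
  let V : Submodule ℝ (HPer r) := LinearMap.eqLocus
    ((projH hr0 N).restrictScalars ℝ : HPer r →ₗ[ℝ] HPer r) LinearMap.id
  have hV : ∀ u, u ∈ V ↔ projH hr0 N u = u := fun u => Iff.rfl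
  -- Conservation needs real values and coercivity needs `V_N`, so the equation is solved in the
  -- intersection, which is closed and hence complete.
  let S : Submodule ℝ (HPer r) := realSubspace r ⊓ V
  have hSc : IsClosed (S : Set (HPer r)) :=
    (isClosed_realSubspace hr0).inter (isClosed_eq (projH hr0 N).continuous continuous_id)
  have : CompleteSpace S := hSc.completeSpace_coe
  have hPP : ∀ u, projH hr0 N (projH hr0 N u) = projH hr0 N u := fun u => by
    refine HPer_ext fun k => ?_
    rw [coef_projH, coef_projH, projSymbol]
    split_ifs <;> simp
  have hPS : ∀ u ∈ realSubspace r, projH hr0 N u ∈ S := fun u hu =>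
    ⟨projH_mem_realSubspace hr0 N hu, (hV _).2 (hPP u)⟩
  have hS : ∀ u ∈ S, projH hr0 N (field hr u) ∈ S := fun u hu =>
    hPS _ (field_mem_realSubspace hr hu.1)
  have hG := lipschitzOnWith_restrictField S hS fun R =>
    (lipschitzOnWith_field hr R).imp fun K hK => lipschitzOnWith_projH_field hr N hK
  obtain ⟨u, hu0, hu⟩ := exists_global_solution_of_conserved hG
    ((energy hr0).bilinearComp S.subtypeL S.subtypeL) (fun x y => energy_symm hr0 _ _)
    (c := (1 + (N : ℝ) ^ 2) ^ r) (fun x => norm_sq_le_energy hr0 ((hV _).1 x.2.2))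
    (fun a x => energy_projH_field hr x.2.1 ((hV _).1 x.2.2) a) ⟨_, hPS u₀ hu₀⟩
  refine ⟨fun t => u t, (isFSGSolution_iff hr).2 ⟨fun t _ => (u t).2.1,
    fun t _ => (hV _).1 (u t).2.2, by rw [hu0], fun t ht => hasDerivWithinAt_coe (hu t ht)⟩⟩

end FBBM

end

/-! ### The main theorem -/

theorem lemma3p3 (α : ℝ) (hα : α ∈ Set.Icc (1 : ℝ) 2) :
    ∃ Tbar C : ℝ → ℝ, ∀ u₀ : FBBM.HPer α, FBBM.IsRealValued u₀ →
      0 < Tbar ‖u₀‖ ∧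
      ∃ uN : ℕ → ℝ → FBBM.HPer α,
        -- `uN N` is the semi-discrete solution, and the only one
        (∀ N, FBBM.IsFSGSolution 1 (1 / 3) 0 α N u₀ (uN N) ∧
          ∀ v, FBBM.IsFSGSolution 1 (1 / 3) 0 α N u₀ v → Set.EqOn v (uN N) (Set.Ici 0)) ∧
        -- bounds that are uniform in `N`
        (∀ N, ∀ t ∈ Set.Icc 0 (Tbar ‖u₀‖),
          FBBM.l2Norm (uN N t) ≤ C ‖u₀‖ ∧
          ‖uN N t‖ ≤ C ‖u₀‖ ∧
          ‖derivWithin (uN N) (Set.Ici 0) t‖ ≤ C ‖u₀‖) ∧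
        -- convergence in `C¹([0, Tbar]; H^α)` to the unique solution
        ∃ u : ℝ → FBBM.HPer α,
          FBBM.IsFBBMSolution α (Tbar ‖u₀‖) u₀ u ∧
          (∀ w, FBBM.IsFBBMSolution α (Tbar ‖u₀‖) u₀ w →
            Set.EqOn w u (Set.Icc 0 (Tbar ‖u₀‖))) ∧
          TendstoUniformlyOn uN u Filter.atTop (Set.Icc 0 (Tbar ‖u₀‖)) ∧
          TendstoUniformlyOn (fun N => derivWithin (uN N) (Set.Ici 0))
            (derivWithin u (Set.Icc 0 (Tbar ‖u₀‖))) Filter.atTop (Set.Icc 0 (Tbar ‖u₀‖)) := by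
  open FBBM in
  have hr : 1 ≤ α := hα.1
  have hr0 : 0 ≤ α := zero_le_one.trans hr
  have hcomplete := completeSpace_HPer hr0
  choose K hK using lipschitzOnWith_field hr
  -- The field vanishes at 0, so `L s` bounds it on the ball of radius `s + 1`. The time `1 / (L s +
  -- 1)` gives a displacement of at most 1, so data of norm `s` stay in that ball.
  let L : ℝ → ℝ := fun s => K (s + 1) * (s + 1)
  let Tbar : ℝ → ℝ := fun s => 1 / (L s + 1)
  refine ⟨Tbar, fun s => √(2 * π) * (s + 1) + (s + 1) + L s, fun u₀ hu₀ => ?_⟩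
  rw [← mem_realSubspace_iff] at hu₀
  set R : ℝ := ‖u₀‖ + 1
  have hR : 0 < R := by positivity
  have hL0 : 0 ≤ L ‖u₀‖ := mul_nonneg (K _).2 hR.le
  have hT : 0 < Tbar ‖u₀‖ := one_div_pos.2 (by linarith)
  set T := Tbar ‖u₀‖
  have hLT : L ‖u₀‖ * T ≤ 1 := by
    have h : L ‖u₀‖ * T = L ‖u₀‖ / (L ‖u₀‖ + 1) := by rw [← mul_one_div]
    rw [h, div_le_one (by linarith)]
    linarith
  have hF : ∀ u : HPer α, ‖u‖ ≤ R → ‖field hr u‖ ≤ L ‖u₀‖ := by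
    intro u hu
    have h := (hK R).norm_sub_le (x := u) (y := 0) (by simpa using hu) (by simpa using hR.le)
    rw [field_zero, sub_zero, sub_zero] at h
    exact h.trans (mul_le_mul_of_nonneg_left hu (K R).2)
  have hPle : ∀ N (u : HPer α), ‖projH hr0 N u‖ ≤ ‖u‖ := fun N u => by
    simpa using (projH hr0 N).le_of_opNorm_le (norm_projH_le hr0 N) u
  have hlip := lipschitzOnWith_field hr
  have hlipN : ∀ N (R : ℝ), ∃ K : NNReal, LipschitzOnWith K
      (fun u => projH hr0 N (field hr u)) (Metric.closedBall 0 R) := fun N R =>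
    (hlip R).imp fun K hK => lipschitzOnWith_projH_field hr N hK
  choose uN huN using fun N => exists_isFSGSolution hr N hu₀
  have huN' := fun N => (isFSGSolution_iff hr).1 (huN N)
  have hdN : ∀ N, ∀ t ∈ Icc 0 T,
      HasDerivWithinAt (uN N) (projH hr0 N (field hr (uN N t))) (Icc 0 T) t := fun N t ht =>
    ((huN' N).2.2.2 t ht.1).mono Icc_subset_Ici_self
  have hderN : ∀ N, ∀ t ∈ Icc 0 T,
      derivWithin (uN N) (Ici 0) t = projH hr0 N (field hr (uN N t)) := fun N t ht =>
    ((huN' N).2.2.2 t ht.1).derivWithin (uniqueDiffOn_Ici 0 t ht.1)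
  -- By uniqueness the global Galerkin solution coincides on `[0, T]` with the local one, which
  -- stays in the ball of radius `R` for every `N`.
  have hbN : ∀ N, ∀ t ∈ Icc 0 T, ‖uN N t‖ ≤ R := by
    intro N t ht
    obtain ⟨v, hv0, hv⟩ := exists_local_solution (hlipN N) hR (L := L ‖u₀‖) (T := T)
      (fun x hx => (hPle N _).trans (hF x hx)) (x₀ := projH hr0 N u₀)
      (add_le_add (hPle N u₀) hLT)
    rw [ode_eqOn_Icc (hlipN N) (hdN N) (fun s hs => (hv s hs).1)
      ((huN' N).2.2.1.trans hv0.symm) ht]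
    exact (hv t ht).2
  have hcS : CompleteSpace (realSubspace α) := (isClosed_realSubspace hr0).completeSpace_coe
  obtain ⟨u, hu0, hu⟩ := exists_local_solution
    (lipschitzOnWith_restrictField (realSubspace α)
      (fun _ => field_mem_realSubspace hr) hlip) hR (L := L ‖u₀‖) (T := T)
    (fun x hx => hF x hx) (x₀ := ⟨u₀, hu₀⟩) (add_le_add le_rfl hLT)
  have hd : ∀ t ∈ Icc 0 T, HasDerivWithinAt (fun t => (u t : HPer α)) (field hr (u t))
      (Icc 0 T) t := fun t ht => hasDerivWithinAt_coe (hu t ht).1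
  have hu0' : (u 0 : HPer α) = u₀ := by rw [hu0]
  have hconv := tendstoUniformlyOn_solutions (P := fun N => (projH hr0 N).restrictScalars ℝ)
    (fun N => by simpa using norm_projH_le hr0 N) (tendsto_projH hr0) hT.le (hK R) hu0'
    (fun N => (huN' N).2.2.1) hd hdN (fun t ht => (hu t ht).2) hbN
  refine ⟨hT, uN, fun N => ⟨huN N, fun v hv => ?_⟩, fun N t ht => ?_, fun t => u t,
    (isFBBMSolution_iff hr hT).2 ⟨fun t _ => (u t).2, hu0', hd⟩, fun w hw => ?_, hconv.1, ?_⟩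
  · have hv' := (isFSGSolution_iff hr).1 hv
    exact ode_eqOn_Ici (hlipN N) hv'.2.2.2 (huN' N).2.2.2
      (hv'.2.2.1.trans (huN' N).2.2.1.symm)
  · have h1 := hbN N t ht
    have h2 := (l2Norm_le hr0 (uN N t)).trans (mul_le_mul_of_nonneg_left h1 (Real.sqrt_nonneg _))
    have h3 : 0 ≤ √(2 * π) * R := by positivity
    refine ⟨by linarith, by linarith, ?_⟩
    rw [hderN N t ht]
    linarith [(hPle N _).trans (hF _ h1)]
  · have hw' := (isFBBMSolution_iff hr hT).1 hw
    exact ode_eqOn_Icc hlip hw'.2.2 hd (hw'.2.1.trans hu0'.symm)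
  · refine (hconv.2.congr (.of_forall fun N t ht => (hderN N t ht).symm)).congr_right fun t ht => ?_
    exact ((hd t ht).derivWithin (uniqueDiffOn_Icc hT t ht)).symm
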